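/- Let $d,M\in\mathbb N$, and let $\Delta\kappa(x)=(x^{m_1},\dots,x^{m_M})\in\mathbb R^M$, $x\in\mathbb R^d$, be a finite list of monomials with arbitrary multi-indices $m_j\in\mathbb N^d$. For $n\ge 1$ set $\omega_n(x,\kappa)=\frac{\Delta\kappa(x)+n\kappa}{n+1}$. Let $0<c<1$ and $h=h_N=N^{c-1}$ for $N\ge 1$. **Data.** Let $\tau(z|y,\kappa)\ge 0$ be a measurable proposal density on $\mathbb R^d$ with $\int\tau(z|y,\kappa)\,dz=1$ for all $(y,\kappa)\in\mathbb R^d\times\mathbb R^M$, and such that $(y,\kappa)\mapsto\int g(z)\tau(z|y,\kappa)\,dz$ is continuous for every bounded continuous $g$. For every $N\ge1$ let $\alpha_N(x,\kappa,y,\kappa')\in[0,1]$ be a measurable acceptance rate. Assume that $\alpha_N\le C h_N$ everywhere, with a constant $C$ independent of $N$, and that $\alpha_N/h_N\to\alpha$ locally uniformly as $N\to\infty$ for some continuous function $\alpha$ (for instance $\alpha_N=h_N\alpha$ for all large $N$, with $\alpha\ge 0$ continuous and bounded). **Chain.** For each $N\ge 1$ let $(x_n,\kappa_n)_{n\ge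 1}$ be the Metropolis Monte Carlo chain in which $x_1$ has a given law $\rho$ on $\mathbb R^d$ and $\kappa_1=\Delta\kappa(x_1)$, and in which, given $(x_n,\kappa_n)$, a proposal $x_p$ is drawn from the density $\tau(\cdot|x_n,\kappa_n)$. With probability $\alpha_N(x_p,\omega_n(x_p,\kappa_n),x_n,\omega_n(x_n,\kappa_n))$ one sets $(x_{n+1},\kappa_{n+1})=(x_p,\omega_n(x_p,\kappa_n))$, and otherwise $(x_{n+1},\kappa_{n+1})=(x_n,\omega_n(x_n,\kappa_n))$. Let $f^N_n$ be the law of $(x_n,\kappa_n)$, a probability measure on $\mathbb R^d\times\mathbb R^M$. **Limit equation.** Let $K(x,y,\kappa)=\alpha(x,\kappa,y,\kappa)\,\tau(x|y,\kappa)$ and $\omega_1(x,\kappa,s)=\frac{\Delta\kappa(x)-\kappa}{s}$. A *weak solution* of $$\partial_s f(x,\kappa,s)=-\operatorname{div}_\kappa[\omega_1(x,\kappa,s) f]+\int K(x,y,\kappa)f(y,\kappa,s)\,dy-\int K(y,x,\kappa)\,dy\; f(x,\kappa,s),\qquad s>0,$$ with initial law $\rho$ is a family $(f_s)_{s>0}$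 of probability measures on $\mathbb R^d\times\mathbb R^M$ that converges weakly, as $s\downarrow0$, to the law of $(x,\Delta\kappa(x))$ with $x\sim\rho$, and such that for every $\varphi\in C_c^\infty(\mathbb R^d\times\mathbb R^M)$ the function $s\mapsto\int\varphi\,df_s$ is differentiable on $(0,\infty)$ with $$\frac{d}{ds}\int\varphi\,df_s=\int\Big(\nabla_\kappa\varphi(y,\kappa)\cdot\omega_1(y,\kappa,s)+\int\varphi(x,\kappa)K(x,y,\kappa)\,dx-\varphi(y,\kappa)\int K(x,y,\kappa)\,dx\Big)\,f_s(dy,d\kappa).$$ **Claim.** There is exactly one such weak solution $(f_s)_{s>0}$, and as $N\to\infty$ (so $h_N\to0$) the laws $f_n^N$ at $s=nh_N$ converge to it weakly, uniformly for bounded $s$: for every bounded continuous $\varphi$ on $\mathbb R^d\times\mathbb R^M$ and every $S>0$, $$\lim_{N\to\infty}\ \sup_{n\ge1,\ nh_N\le S}\Big|\int\varphi\,df^N_n-\int\varphi\,df_{nh_N}\Big|=0 .$$ -/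

import Mathlib

open MeasureTheory Filter Topology
open scoped BoundedContinuousFunction ContDiff

namespace MMC

/-- The state space `ℝ^d` and the moment space `ℝ^M`; only their topology, smooth structure and
Lebesgue measure matter below. -/
abbrev Vec (d : ℕ) : Type := Fin d → ℝ

/-- The moment increment `Δκ(x) = (x, x², …)`: a finite list of monomials in the coordinates of
`x ∈ ℝ^d`. The `j`-th entry has the multi-index `m j`. -/
def momentIncr {d M : ℕ} (m : Fin M → Fin d → ℕ) (x : Vec d) : Vec M :=
  fun j => ∏ i, x i ^ m j i

/-- The moment update `ω_n(x, κ) = (Δκ(x) + n κ) / (n + 1)`. -/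
noncomputable def momentUpdate {d M : ℕ} (m : Fin M → Fin d → ℕ) (n : ℕ) (x : Vec d)
    (κ : Vec M) : Vec M :=
  ((n : ℝ) + 1)⁻¹ • (momentIncr m x + (n : ℝ) • κ)

/-- The conditional law of `(x_{n+1}, κ_{n+1})` given `(x_n, κ_n) = p`: a proposal `z` is drawn from
the density `τ(· | x_n, κ_n)`; with probability
`α(z, ω_n(z, κ_n), x_n, ω_n(x_n, κ_n))` the chain moves to `(z, ω_n(z, κ_n))`, otherwise to
`(x_n, ω_n(x_n, κ_n))`. -/
noncomputable def stepLaw {d M : ℕ} (m : Fin M → Fin d → ℕ)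
    (τ : Vec d → Vec d → Vec M → ℝ) (α : Vec d → Vec M → Vec d → Vec M → ℝ)
    (n : ℕ) (p : Vec d × Vec M) : Measure (Vec d × Vec M) :=
  (volume.withDensity fun z => ENNReal.ofReal (τ z p.1 p.2)).bind fun z =>
    ENNReal.ofReal (α z (momentUpdate m n z p.2) p.1 (momentUpdate m n p.1 p.2)) •
        Measure.dirac (z, momentUpdate m n z p.2) +
      ENNReal.ofReal (1 - α z (momentUpdate m n z p.2) p.1 (momentUpdate m n p.1 p.2)) •
        Measure.dirac (p.1, momentUpdate m n p.1 p.2)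

/-- The law `f_n` of `(x_n, κ_n)`, for `n ≥ 1`, when `x_1` has law `ρ` and `κ_1 = Δκ(x_1)`.
The value at the index `0` is a dummy. -/
noncomputable def chainLaw {d M : ℕ} (m : Fin M → Fin d → ℕ)
    (τ : Vec d → Vec d → Vec M → ℝ) (α : Vec d → Vec M → Vec d → Vec M → ℝ)
    (ρ : Measure (Vec d)) : ℕ → Measure (Vec d × Vec M)
  | 0 => ρ.map fun x => (x, momentIncr m x)
  | 1 => ρ.map fun x => (x, momentIncr m x)
  | n + 2 => (chainLaw m τ α ρ (n + 1)).bind (stepLaw m τ α (n + 1))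

/-- The step size `h = N^(c-1)`. -/
noncomputable def stepSize (c : ℝ) (N : ℕ) : ℝ := (N : ℝ) ^ (c - 1)

/-- The limiting moment drift `ω₁(x, κ, s) = (Δκ(x) - κ) / s`. -/
noncomputable def momentDrift {d M : ℕ} (m : Fin M → Fin d → ℕ) (x : Vec d) (κ : Vec M)
    (s : ℝ) : Vec M :=
  s⁻¹ • (momentIncr m x - κ)

/-- The kernel `K(x, y, κ) = α(x, κ, y, κ) τ(x | y, κ)`. -/
def kineticKernel {d M : ℕ} (τ : Vec d → Vec d → Vec M → ℝ)
    (α : Vec d → Vec M → Vec d → Vec M → ℝ) (x y : Vec d) (κ : Vec M) : ℝ :=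
  α x κ y κ * τ x y κ

/-- Weak solutions `(f_s)_{s > 0}`, with values in the probability measures on `ℝ^d × ℝ^M`, of
`∂_s f = - div_κ [ω₁ f] + ∫ K(x, y, κ) f(y, κ, s) dy - ∫ K(y, x, κ) dy f(x, κ, s)`
whose initial value is the law of `(x, Δκ(x))` for `x` distributed according to `ρ`. In the
equation tested with `φ`, the derivative `fderiv ℝ φ (y, κ) (0, ω₁)` is `∇_κ φ(y, κ) · ω₁`. -/
structure IsKineticSolution {d M : ℕ} (m : Fin M → Fin d → ℕ)
    (τ : Vec d → Vec d → Vec M → ℝ) (α : Vec d → Vec M → Vec d → Vec M → ℝ)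
    (ρ : Measure (Vec d)) (f : ℝ → Measure (Vec d × Vec M)) : Prop where
  isProbabilityMeasure : ∀ s, 0 < s → IsProbabilityMeasure (f s)
  initial : ∀ φ : (Vec d × Vec M) →ᵇ ℝ,
    Tendsto (fun s => ∫ p, φ p ∂(f s)) (𝓝[>] 0) (𝓝 (∫ x, φ (x, momentIncr m x) ∂ρ))
  evolution : ∀ φ : Vec d × Vec M → ℝ, ContDiff ℝ ∞ φ → HasCompactSupport φ → ∀ s, 0 < s →
    HasDerivAt (fun t => ∫ p, φ p ∂(f t))
      (∫ p, (fderiv ℝ φ p (0, momentDrift m p.1 p.2 s)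
          + (∫ x, φ (x, p.2) * kineticKernel τ α x p.1 p.2)
          - φ p * ∫ x, kineticKernel τ α x p.1 p.2) ∂(f s)) s

end MMC

/-! The acceptance rate is uniformised. With `L = C + 1` and `γ = L h`, the quotient `β_N = α_N / (L
h)` is again an acceptance probability. One step of the chain is then a combination of a pure moment
update, with weight `1 - γ`, and of an attempted jump, with weight `γ`, that is, a step with
acceptance `β_N` (`integral_stepLaw_eq`). A moment update is a map `relax m θ`, where `θ` is the
ratio of the old time to the new one, and these ratios multiply (`relax_relax`). Since the start
lies on `κ = Δκ(x)`, a path without jumps does not move, which makes the singularity `1 / s` of the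
drift harmless.

Expanding in the number `j` of attempted jumps writes the law after `k` steps as the sum of `(1 - γ)
^ (k - j) γ ^ j` times `chainPart j k`, a measure of mass `k.choose j` (`integral_chainLaw`).
Splitting by the position of the last attempted jump turns `k ^ (-j)` times `chainPart j k` into a
Riemann sum. By induction on `j` it converges weakly to `jumpPart j`, where `jumpPart (j + 1)` is
the integral over `θ` in `(0, 1]`, with weight `θ ^ j`, of the image under `relax m θ` of `jumpPart
j` followed by one limiting jump (`tendsto_integral_chainPart`). The Feller property of `τ` and the
local uniform convergence of the rates enter through `tendsto_integral_jumpLaw`. If `k γ → L t`,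
dominated convergence of the series yields the Poisson mixture `kineticFlow`
(`tendsto_integral_chainLaw`). Its coefficients do not depend on time, because relaxation sees only
ratios of times.

This mixture solves the equation: integration by parts in `θ` expresses the relaxation generator on
`jumpPart (j + 1)` by the mass at level `j + 1` and the jumps out of level `j`
(`isKineticSolution_kineticFlow`). For uniqueness, a solution is tested along characteristics, so
that the drift disappears and only the bounded jump operator remains. Iterating the resulting
integral inequality bounds the difference of two solutions by a multiple of `(2 L t) ^ k / k!` for
every `k`.

Uniformity for bounded times follows by compactness: times at which convergence fails would cluster
at some `t` in `[0, S]`, but along `n h → t` the chain and the flow have the same limit. -/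

namespace MMC

/-! ### Weak convergence with varying integrands -/

section Limits

variable {E : Type*} [NormedAddCommGroup E]

/-- A continuous function with values in `[0, 1]` that vanishes on the ball of radius `R` and is `1`
outside the ball of radius `R + 1`. -/
noncomputable def tailWeight (E : Type*) [NormedAddCommGroup E] (R : ℝ) : E →ᵇ ℝ :=
  BoundedContinuousFunction.ofNormedAddCommGroup (fun p => min 1 (max 0 (‖p‖ - R)))
    (by fun_prop) 1 (fun p => by
      rw [Real.norm_of_nonneg (by positivity)]
      exact min_le_left _ _)

theorem tailWeight_apply (R : ℝ) (p : E) : tailWeight E R p = min 1 (max 0 (‖p‖ - R)) := rfl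

theorem tailWeight_nonneg (R : ℝ) (p : E) : 0 ≤ tailWeight E R p := by
  rw [tailWeight_apply]; positivity

theorem tailWeight_le_one (R : ℝ) (p : E) : tailWeight E R p ≤ 1 := min_le_left _ _

theorem tailWeight_eq_one {R : ℝ} {p : E} (hp : R + 1 ≤ ‖p‖) : tailWeight E R p = 1 := by
  rw [tailWeight_apply]
  exact min_eq_left (le_max_of_le_right (by linarith))

theorem tailWeight_eq_zero {R : ℝ} {p : E} (hp : ‖p‖ ≤ R) : tailWeight E R p = 0 := by
  rw [tailWeight_apply, max_eq_left (by linarith)]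
  exact min_eq_right zero_le_one

/-- Near `p` the values `ψ i q` are close to `ψ' p` for all late `i` at once; letting `i` run with
`q` fixed gives the same for `ψ' q`. -/
theorem continuous_of_tendsto_prod_nhds {ι : Type*} {l : Filter ι} [l.NeBot] {ψ : ι → E → ℝ}
    {ψ' : E → ℝ} (hψ : ∀ p, Tendsto (Function.uncurry ψ) (l ×ˢ 𝓝 p) (𝓝 (ψ' p))) :
    Continuous ψ' := by
  refine continuous_iff_continuousAt.2 fun p => ?_
  refine Metric.tendsto_nhds.2 fun ε hε => ?_
  have h := Metric.tendsto_nhds.1 (hψ p) (ε / 2) (half_pos hε)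
  obtain ⟨A, hA, U, hU, hAU⟩ := eventually_prod_iff.1 h
  filter_upwards [hU] with q hq
  have hq' : Tendsto (fun i => ψ i q) l (𝓝 (ψ' q)) :=
    (hψ q).comp (tendsto_id.prodMk (tendsto_const_nhds (x := q)))
  have : dist (ψ' q) (ψ' p) ≤ ε / 2 :=
    le_of_tendsto (hq'.dist tendsto_const_nhds) (hA.mono fun i hi => (hAU hi hq).le)
  linarith

variable [MeasurableSpace E] [OpensMeasurableSpace E]

theorem exists_integral_tailWeight_lt (μ : Measure E) [IsFiniteMeasure μ] {ε : ℝ} (hε : 0 < ε) :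
    ∃ R, ∫ p, tailWeight E R p ∂μ < ε := by
  have h : Tendsto (fun R : ℝ => ∫ p, tailWeight E R p ∂μ) atTop (𝓝 (∫ _, (0 : ℝ) ∂μ)) := by
    refine tendsto_integral_filter_of_dominated_convergence (fun _ => 1) ?_ ?_
      (integrable_const _) ?_
    · exact .of_forall fun R => (tailWeight E R).continuous.measurable.aestronglyMeasurable
    · refine .of_forall fun R => .of_forall fun p => ?_
      rw [Real.norm_of_nonneg (tailWeight_nonneg R p)]
      exact tailWeight_le_one R p
    · refine .of_forall fun p => tendsto_const_nhds.congr' ?_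
      filter_upwards [eventually_ge_atTop ‖p‖] with R hR
      exact (tailWeight_eq_zero hR).symm
  rw [integral_zero] at h
  exact (h.eventually (gt_mem_nhds hε)).exists

theorem integrable_of_continuous_of_bound (μ : Measure E) [IsFiniteMeasure μ] {φ : E → ℝ}
    (hφ : Continuous φ) {B : ℝ} (hB : ∀ p, |φ p| ≤ B) : Integrable φ μ :=
  .of_bound hφ.measurable.aestronglyMeasurable B (.of_forall hB)

theorem abs_integral_sub_le_of_approx (μ : Measure E) [IsProbabilityMeasure μ] {φ g : E → ℝ}
    (hφ : Integrable φ μ) (hg : Integrable g μ) {ε B R : ℝ}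
    (h : ∀ p, |g p - φ p| ≤ ε + B * tailWeight E R p) :
    |∫ p, g p ∂μ - ∫ p, φ p ∂μ| ≤ ε + B * ∫ p, tailWeight E R p ∂μ := by
  rw [← integral_sub hg hφ]
  have hi : Integrable (fun p => B * tailWeight E R p) μ :=
    ((tailWeight E R).integrable μ).const_mul B
  refine (norm_integral_le_of_norm_le (f := fun p => g p - φ p)
    (g := fun p => ε + B * tailWeight E R p) ((integrable_const ε).add hi) (.of_forall h)).trans ?_
  rw [integral_add (integrable_const ε) hi, integral_const_mul]
  simp

/-- If `ν i → ν'` weakly and `ψ i → ψ'` continuously and boundedly, then `∫ ψ i ∂ν i → ∫ ψ' ∂ν'`. -/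
theorem tendsto_integral_of_tendsto_prod_nhds [ProperSpace E] {ι : Type*} {l : Filter ι}
    {ν : ι → Measure E} {ν' : Measure E} [IsFiniteMeasure ν']
    (hfin : ∀ᶠ i in l, IsFiniteMeasure (ν i))
    (hν : ∀ φ : E →ᵇ ℝ, Tendsto (fun i => ∫ p, φ p ∂(ν i)) l (𝓝 (∫ p, φ p ∂ν')))
    {ψ : ι → E → ℝ} {ψ' : E → ℝ} {B : ℝ} (hmeas : ∀ᶠ i in l, Measurable (ψ i))
    (hB : ∀ᶠ i in l, ∀ p, |ψ i p| ≤ B)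
    (hψ : ∀ p, Tendsto (Function.uncurry ψ) (l ×ˢ 𝓝 p) (𝓝 (ψ' p))) :
    Tendsto (fun i => ∫ p, ψ i p ∂(ν i)) l (𝓝 (∫ p, ψ' p ∂ν')) := by
  rcases l.eq_or_neBot with rfl | _
  · exact tendsto_bot
  have hcont := continuous_of_tendsto_prod_nhds hψ
  have hB' : ∀ p, |ψ' p| ≤ B := fun p =>
    le_of_tendsto ((hψ p).comp (tendsto_id.prodMk (tendsto_const_nhds (x := p)))).abs
      (hB.mono fun i hi => hi p)
  have hB0 : 0 ≤ B := (abs_nonneg _).trans (hB' 0)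
  let Φ : E →ᵇ ℝ := BoundedContinuousFunction.ofNormedAddCommGroup ψ' hcont B hB'
  have hΦ : Tendsto (fun i => ∫ p, ψ' p ∂(ν i)) l (𝓝 (∫ p, ψ' p ∂ν')) := hν Φ
  suffices h : Tendsto (fun i => ∫ p, ψ i p ∂(ν i) - ∫ p, ψ' p ∂(ν i)) l (𝓝 0) by
    simpa using h.add hΦ
  refine Metric.tendsto_nhds.2 fun ε hε => ?_
  have hm : 0 ≤ ν'.real Set.univ := measureReal_nonneg
  obtain ⟨δ, hδ, hδε⟩ : ∃ δ > 0, δ * ν'.real Set.univ + 2 * B * δ < ε := by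
    refine ⟨ε / (2 * (ν'.real Set.univ + 2 * B + 1)), by positivity, ?_⟩
    have : ε / (2 * (ν'.real Set.univ + 2 * B + 1)) * (ν'.real Set.univ + 2 * B) < ε := by
      rw [div_mul_eq_mul_div, div_lt_iff₀ (by positivity)]
      nlinarith [mul_nonneg hm hε.le, mul_nonneg hB0 hε.le]
    linarith
  obtain ⟨R, hR⟩ := exists_integral_tailWeight_lt ν' hδ
  have hunif : ∀ᶠ i in l, ∀ p ∈ Metric.closedBall (0 : E) (R + 1), |ψ i p - ψ' p| ≤ δ := by
    have hK := isCompact_closedBall (0 : E) (R + 1)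
    refine hK.induction_on (p := fun s => ∀ᶠ i in l, ∀ p ∈ s, |ψ i p - ψ' p| ≤ δ) ?_ ?_ ?_ ?_
    · simp
    · exact fun s t hst h => h.mono fun i hi p hp => hi p (hst hp)
    · intro s t hs ht
      filter_upwards [hs, ht] with i h1 h2 p hp
      exact hp.elim (h1 p) (h2 p)
    · intro p _
      have h1 := Metric.tendsto_nhds.1 (hψ p) (δ / 2) (half_pos hδ)
      obtain ⟨A, hA, U, hU, hAU⟩ := eventually_prod_iff.1 h1
      have h2 := Metric.tendsto_nhds.1 (hcont.tendsto p) (δ / 2) (half_pos hδ)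
      refine ⟨{q | U q ∧ dist (ψ' q) (ψ' p) < δ / 2}, mem_nhdsWithin_of_mem_nhds (hU.and h2), ?_⟩
      filter_upwards [hA] with i hi q hq
      have h3 := hAU hi hq.1
      have h4 := hq.2
      have h5 := dist_triangle_right (ψ i q) (ψ' q) (ψ' p)
      rw [← Real.dist_eq]
      exact h5.trans (by simp only [Function.uncurry] at h3; linarith)
  -- `G` eventually dominates `|ψ i - ψ'|`: uniform convergence on the ball gives `δ`, and outside
  -- it the trivial bound `2 * B` applies. As `G` is one fixed bounded continuous function, weak
  -- convergence alone controls its integrals.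
  let G : E →ᵇ ℝ := BoundedContinuousFunction.const E δ + (2 * B) • tailWeight E R
  have hG : ∀ p, G p = δ + 2 * B * tailWeight E R p := fun p => rfl
  have hGlim : ∫ p, G p ∂ν' < ε := by
    simp only [hG]
    rw [integral_add (integrable_const _) (((tailWeight E R).integrable ν').const_mul _),
      integral_const, integral_const_mul, smul_eq_mul, mul_comm (ν'.real Set.univ)]
    have := mul_le_mul_of_nonneg_left hR.le (by positivity : 0 ≤ 2 * B)
    linarith
  filter_upwards [hfin, hmeas, hB, hunif, (hν G).eventually (gt_mem_nhds hGlim)]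
    with i h1 h2 h3 h4 h5
  have i1 : Integrable (ψ i) (ν i) := .of_bound h2.aestronglyMeasurable B (.of_forall h3)
  rw [dist_zero_right, ← integral_sub i1 (integrable_of_continuous_of_bound (ν i) hcont hB')]
  refine (norm_integral_le_of_norm_le (G.integrable (ν i)) (.of_forall fun p => ?_)).trans_lt h5
  rw [hG, Real.norm_eq_abs]
  by_cases hp : ‖p‖ ≤ R + 1
  · have := mul_nonneg (by positivity : 0 ≤ 2 * B) (tailWeight_nonneg R p)
    have := h4 p (by simpa using hp)
    linarith
  · rw [tailWeight_eq_one (by linarith)]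
    have := abs_sub (ψ i p) (ψ' p)
    have := h3 p
    have := hB' p
    linarith

end Limits

/-! ### Approximation by smooth compactly supported functions -/

section Approximation

variable {E : Type*} [NormedAddCommGroup E] [NormedSpace ℝ E] [FiniteDimensional ℝ E]

/-- Smoothing can be done without enlarging the support of the truncated function, which lies in a
compact ball. -/
theorem exists_testFunction_near {φ : E → ℝ} (hφ : Continuous φ) (R : ℝ) {ε : ℝ} (hε : 0 < ε) :
    ∃ g : E → ℝ, ContDiff ℝ ∞ g ∧ HasCompactSupport g ∧
      ∀ p, |g p - (1 - tailWeight E R p) * φ p| ≤ ε := by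
  have hc : Continuous fun p => (1 - tailWeight E R p) * φ p :=
    (continuous_const.sub (tailWeight E R).continuous).mul hφ
  obtain ⟨g, h1, h2, h3⟩ := hc.exists_contDiff_approx ⊤ (ε := fun _ => ε) (by fun_prop)
    (fun _ => hε)
  refine ⟨g, h1, ?_, fun p => by simpa [Real.dist_eq] using (h2 p).le⟩
  have : ProperSpace E := FiniteDimensional.proper_real E
  refine HasCompactSupport.intro (isCompact_closedBall (0 : E) (R + 1)) fun p hp => ?_
  by_contra hg
  have := h3 hg
  rw [mem_closedBall_zero_iff, not_le] at hp
  simp [tailWeight_eq_one hp.le] at this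

/-- The error splits into `ε` from smoothing and `B * tailWeight` from truncation. -/
theorem exists_testFunction_sub_le {φ : E → ℝ} (hφ : Continuous φ) {B : ℝ}
    (hB : ∀ p, |φ p| ≤ B) (R : ℝ) {ε : ℝ} (hε : 0 < ε) :
    ∃ g : E → ℝ, ContDiff ℝ ∞ g ∧ HasCompactSupport g ∧ (∀ p, |g p| ≤ B + ε) ∧
      ∀ p, |g p - φ p| ≤ ε + B * tailWeight E R p := by
  obtain ⟨g, h1, h2, h3⟩ := exists_testFunction_near hφ R hε
  refine ⟨g, h1, h2, fun p => ?_, fun p => ?_⟩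
  · have h4 : |(1 - tailWeight E R p) * φ p| ≤ B := by
      rw [abs_mul, abs_of_nonneg (by linarith [tailWeight_le_one R p])]
      nlinarith [tailWeight_nonneg R p, hB p, abs_nonneg (φ p), tailWeight_le_one R p]
    have := abs_sub_abs_le_abs_sub (g p) ((1 - tailWeight E R p) * φ p)
    linarith [h3 p]
  · have h4 : |tailWeight E R p * φ p| ≤ B * tailWeight E R p := by
      rw [abs_mul, abs_of_nonneg (tailWeight_nonneg R p), mul_comm]
      exact mul_le_mul_of_nonneg_right (hB p) (tailWeight_nonneg R p)
    have := abs_sub (g p - (1 - tailWeight E R p) * φ p) (tailWeight E R p * φ p)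
    rw [show g p - (1 - tailWeight E R p) * φ p - tailWeight E R p * φ p = g p - φ p by ring]
      at this
    linarith [h3 p]

variable [MeasurableSpace E] [OpensMeasurableSpace E]

/-- A bound on the difference of two integrals extends from test functions to bounded continuous
functions. -/
theorem abs_integral_sub_integral_le_of_testFunction {μ ν : Measure E} [IsProbabilityMeasure μ]
    [IsProbabilityMeasure ν] {b : ℝ}
    (h : ∀ (g : E → ℝ) (B : ℝ), ContDiff ℝ ∞ g → HasCompactSupport g → (∀ p, |g p| ≤ B) →
      |∫ p, g p ∂μ - ∫ p, g p ∂ν| ≤ B * b)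
    {φ : E → ℝ} (hφ : Continuous φ) {B : ℝ} (hB : ∀ p, |φ p| ≤ B) :
    |∫ p, φ p ∂μ - ∫ p, φ p ∂ν| ≤ B * b := by
  have hB0 : 0 ≤ B := (abs_nonneg _).trans (hB 0)
  have key : ∀ ε : ℝ, 0 < ε →
      |∫ p, φ p ∂μ - ∫ p, φ p ∂ν| ≤ (B + ε) * b + 2 * (ε + B * ε) := by
    intro ε hε
    -- Choosing the radius for the sum of the two measures gives one truncation that serves both.
    obtain ⟨R, hR⟩ := exists_integral_tailWeight_lt (μ + ν) hε
    rw [integral_add_measure ((tailWeight E R).integrable μ) ((tailWeight E R).integrable ν)] at hR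
    have n1 : 0 ≤ ∫ p, tailWeight E R p ∂μ := integral_nonneg (tailWeight_nonneg R)
    have n2 : 0 ≤ ∫ p, tailWeight E R p ∂ν := integral_nonneg (tailWeight_nonneg R)
    obtain ⟨g, g1, g2, g3, g4⟩ := exists_testFunction_sub_le hφ hB R hε
    have a1 := abs_integral_sub_le_of_approx μ (integrable_of_continuous_of_bound μ hφ hB)
      (integrable_of_continuous_of_bound μ g1.continuous g3) g4
    have a2 := abs_integral_sub_le_of_approx ν (integrable_of_continuous_of_bound ν hφ hB)
      (integrable_of_continuous_of_bound ν g1.continuous g3) g4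
    have a3 := h g (B + ε) g1 g2 g3
    have m1 := mul_le_mul_of_nonneg_left (by linarith : ∫ p, tailWeight E R p ∂μ ≤ ε) hB0
    have m2 := mul_le_mul_of_nonneg_left (by linarith : ∫ p, tailWeight E R p ∂ν ≤ ε) hB0
    rw [abs_le] at *
    constructor <;> linarith [a1.1, a1.2, a2.1, a2.2, a3.1, a3.2]
  have hlim : Tendsto (fun ε : ℝ => (B + ε) * b + 2 * (ε + B * ε)) (𝓝[>] 0) (𝓝 (B * b)) := by
    have : ContinuousAt (fun ε : ℝ => (B + ε) * b + 2 * (ε + B * ε)) 0 := by fun_prop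
    simpa using this.tendsto.mono_left nhdsWithin_le_nhds
  exact ge_of_tendsto hlim (by filter_upwards [self_mem_nhdsWithin] with ε hε using key ε hε)

/-- Vague convergence of probability measures to a probability measure is weak convergence. -/
theorem tendsto_integral_of_testFunction {ι : Type*} {l : Filter ι} {ν : ι → Measure E}
    {ν' : Measure E} [IsProbabilityMeasure ν'] (hν : ∀ᶠ i in l, IsProbabilityMeasure (ν i))
    (h : ∀ g : E → ℝ, ContDiff ℝ ∞ g → HasCompactSupport g →
      Tendsto (fun i => ∫ p, g p ∂(ν i)) l (𝓝 (∫ p, g p ∂ν')))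
    (φ : E →ᵇ ℝ) : Tendsto (fun i => ∫ p, φ p ∂(ν i)) l (𝓝 (∫ p, φ p ∂ν')) := by
  set B := ‖φ‖ with hBdef
  have hB0 : 0 ≤ B := norm_nonneg φ
  have hB : ∀ p, |φ p| ≤ B := φ.norm_coe_le_norm
  refine Metric.tendsto_nhds.2 fun ε hε => ?_
  obtain ⟨δ, hδ, hδε⟩ : ∃ δ > 0, 3 * δ + 5 * (B * δ) < ε := by
    refine ⟨ε / (10 * (B + 1)), by positivity, ?_⟩
    have : ε / (10 * (B + 1)) * (3 + 5 * B) < ε := by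
      rw [div_mul_eq_mul_div, div_lt_iff₀ (by positivity)]
      nlinarith [mul_nonneg hB0 hε.le]
    linarith
  obtain ⟨R, hR⟩ := exists_integral_tailWeight_lt ν' hδ
  obtain ⟨g, g1, g2, g3, g4⟩ := exists_testFunction_sub_le φ.continuous hB R hδ
  -- `χ` is a smooth copy of the cut-off. All measures have mass one, so convergence of the
  -- integrals of `χ` transfers the small tail of `ν'` to `ν i`: this is where no mass escapes to
  -- infinity.
  obtain ⟨χ, c1, c2, c3⟩ := exists_testFunction_near (E := E) (continuous_const (y := (1 : ℝ))) R hδ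
  have c4 : ∀ p, |χ p| ≤ 1 + δ := fun p => by
    have := c3 p
    have := tailWeight_le_one R p
    have := tailWeight_nonneg R p
    rw [abs_le] at *
    constructor <;> linarith
  filter_upwards [hν, Metric.tendsto_nhds.1 (h g g1 g2) δ hδ,
    Metric.tendsto_nhds.1 (h χ c1 c2) δ hδ] with i h1 h2 h3
  have tail : ∀ μ : Measure E, IsProbabilityMeasure μ →
      |∫ p, χ p ∂μ - (1 - ∫ p, tailWeight E R p ∂μ)| ≤ δ := by
    intro μ _
    have ht := (tailWeight E R).integrable μ
    have e : 1 - ∫ p, tailWeight E R p ∂μ = ∫ p, (1 - tailWeight E R p) * 1 ∂μ := by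
      simp only [mul_one]
      rw [integral_sub (integrable_const _) ht]
      simp
    rw [e, ← integral_sub (integrable_of_continuous_of_bound μ c1.continuous c4)
      (show Integrable (fun p => (1 - tailWeight E R p) * 1) μ from
        ((integrable_const 1).sub ht).mul_const 1)]
    refine (norm_integral_le_of_norm_le (f := fun p => χ p - (1 - tailWeight E R p) * 1)
      (integrable_const δ) (.of_forall c3)).trans ?_
    simp
  have t1 := tail (ν i) h1
  have t2 := tail ν' inferInstance
  have a1 := abs_integral_sub_le_of_approx (ν i) (φ.integrable _)
    (integrable_of_continuous_of_bound _ g1.continuous g3) g4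
  have a2 := abs_integral_sub_le_of_approx ν' (φ.integrable _)
    (integrable_of_continuous_of_bound _ g1.continuous g3) g4
  rw [Real.dist_eq] at *
  have t3 : ∫ p, tailWeight E R p ∂(ν i) ≤ 4 * δ := by
    rw [abs_le] at t1 t2
    rw [abs_lt] at h3
    linarith [t1.1, t1.2, t2.1, t2.2, h3.1, h3.2]
  have m1 := mul_le_mul_of_nonneg_left t3 hB0
  have m2 := mul_le_mul_of_nonneg_left hR.le hB0
  rw [abs_le] at a1 a2
  rw [abs_lt] at *
  constructor <;> linarith [a1.1, a1.2, a2.1, a2.2, h2.1, h2.2]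

end Approximation

end MMC

namespace MMC

/-! ### Integration against mixtures of measures -/

section Bind

variable {X Y : Type*} [MeasurableSpace X] [MeasurableSpace Y]

theorem integral_bind {μ : Measure X} {κ : X → Measure Y} (hκ : Measurable κ) {f : Y → ℝ}
    (hf : Integrable f (μ.bind κ)) : ∫ y, f y ∂(μ.bind κ) = ∫ x, ∫ y, f y ∂(κ x) ∂μ := by
  have := ProbabilityTheory.Kernel.integral_comp (κ := ProbabilityTheory.Kernel.const Unit μ)
    (η := ⟨κ, hκ⟩) (a := ()) (f := f)
  rw [ProbabilityTheory.Kernel.comp_apply, ProbabilityTheory.Kernel.const_apply] at this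
  exact this hf

theorem bind_apply_univ {μ : Measure X} {κ : X → Measure Y} (hκ : Measurable κ)
    (h1 : ∀ x, IsProbabilityMeasure (κ x)) : μ.bind κ Set.univ = μ Set.univ := by
  rw [Measure.bind_apply .univ hκ.aemeasurable]
  simp

theorem isFiniteMeasure_bind {μ : Measure X} [IsFiniteMeasure μ] {κ : X → Measure Y}
    (hκ : Measurable κ) (h1 : ∀ x, IsProbabilityMeasure (κ x)) : IsFiniteMeasure (μ.bind κ) :=
  ⟨by rw [bind_apply_univ hκ h1]; exact measure_lt_top _ _⟩

theorem integral_bind_of_bound {μ : Measure X} [IsFiniteMeasure μ] {κ : X → Measure Y}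
    (hκ : Measurable κ) (h1 : ∀ x, IsProbabilityMeasure (κ x)) {f : Y → ℝ} (hf : Measurable f)
    {B : ℝ} (hB : ∀ y, |f y| ≤ B) : ∫ y, f y ∂(μ.bind κ) = ∫ x, ∫ y, f y ∂(κ x) ∂μ := by
  have := isFiniteMeasure_bind (μ := μ) hκ h1
  exact integral_bind hκ (.of_bound hf.aestronglyMeasurable B (.of_forall hB))

theorem abs_integral_le_of_bound {μ : Measure X} [IsProbabilityMeasure μ] {f : X → ℝ} {B : ℝ}
    (hB : ∀ x, |f x| ≤ B) : |∫ x, f x ∂μ| ≤ B := by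
  simpa using norm_integral_le_of_norm_le_const (μ := μ) (f := f) (C := B) (.of_forall hB)

theorem measurable_integral_of_measurable {κ : X → Measure Y} (hκ : Measurable κ)
    (h1 : ∀ x, IsProbabilityMeasure (κ x)) {f : Y → ℝ} (hf : Measurable f) :
    Measurable fun x => ∫ y, f y ∂(κ x) := by
  let K : ProbabilityTheory.Kernel X Y := ⟨κ, hκ⟩
  have : ProbabilityTheory.IsMarkovKernel K := ⟨h1⟩
  have := (hf.comp measurable_snd).stronglyMeasurable.integral_kernel_prod_right' (κ := K)
  exact this.measurable

end Bind

variable {d M : ℕ}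

/-! ### One Metropolis step with a general moment update -/

section Jump

/-- Measurable proposal densities whose laws depend weakly continuously on the state. -/
structure IsFellerDensity (τ : Vec d → Vec d → Vec M → ℝ) : Prop where
  measurable : Measurable fun q : Vec d × Vec d × Vec M => τ q.1 q.2.1 q.2.2
  nonneg : ∀ z y κ, 0 ≤ τ z y κ
  integral_eq_one : ∀ y κ, ∫ z, τ z y κ = 1
  continuous_integral : ∀ g : Vec d →ᵇ ℝ,
    Continuous fun p : Vec d × Vec M => ∫ z, g z * τ z p.1 p.2

/-- Measurable acceptance probabilities. -/
structure IsAcceptance (β : Vec d → Vec M → Vec d → Vec M → ℝ) : Prop where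
  measurable : Measurable fun q : Vec d × Vec M × Vec d × Vec M => β q.1 q.2.1 q.2.2.1 q.2.2.2
  nonneg : ∀ x κ y κ', 0 ≤ β x κ y κ'
  le_one : ∀ x κ y κ', β x κ y κ' ≤ 1

/-- The law of the proposal at the state `p`. -/
noncomputable def proposalLaw (τ : Vec d → Vec d → Vec M → ℝ) (p : Vec d × Vec M) :
    Measure (Vec d) :=
  volume.withDensity fun z => ENNReal.ofReal (τ z p.1 p.2)

/-- One step of the chain when the moments are updated by `u`. -/
noncomputable def jumpLaw (u : Vec d → Vec M → Vec M) (τ : Vec d → Vec d → Vec M → ℝ)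
    (β : Vec d → Vec M → Vec d → Vec M → ℝ) (p : Vec d × Vec M) : Measure (Vec d × Vec M) :=
  (proposalLaw τ p).bind fun z =>
    ENNReal.ofReal (β z (u z p.2) p.1 (u p.1 p.2)) • Measure.dirac (z, u z p.2) +
      ENNReal.ofReal (1 - β z (u z p.2) p.1 (u p.1 p.2)) • Measure.dirac (p.1, u p.1 p.2)

theorem stepLaw_eq_jumpLaw (m : Fin M → Fin d → ℕ) (τ : Vec d → Vec d → Vec M → ℝ)
    (β : Vec d → Vec M → Vec d → Vec M → ℝ) (n : ℕ) :
    stepLaw m τ β n = jumpLaw (momentUpdate m n) τ β := rfl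

variable {τ : Vec d → Vec d → Vec M → ℝ} {β : Vec d → Vec M → Vec d → Vec M → ℝ}
  {u : Vec d → Vec M → Vec M}

theorem IsFellerDensity.measurable_left (hτ : IsFellerDensity τ) (p : Vec d × Vec M) :
    Measurable fun z => τ z p.1 p.2 :=
  hτ.measurable.comp (measurable_id.prodMk measurable_const)

theorem IsFellerDensity.isProbabilityMeasure (hτ : IsFellerDensity τ) (p : Vec d × Vec M) :
    IsProbabilityMeasure (proposalLaw τ p) := by
  refine ⟨?_⟩
  -- The integral of a non-integrable function is `0` by convention, so the normalisation to `1`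
  -- already forces integrability.
  have hi : Integrable fun z => τ z p.1 p.2 := by
    by_contra h
    have := hτ.integral_eq_one p.1 p.2
    rw [integral_undef h] at this
    exact zero_ne_one this
  rw [proposalLaw, withDensity_apply _ .univ, Measure.restrict_univ,
    ← ofReal_integral_eq_lintegral_ofReal hi (.of_forall fun z => hτ.nonneg _ _ _),
    hτ.integral_eq_one, ENNReal.ofReal_one]

theorem IsFellerDensity.measurable_proposalLaw (hτ : IsFellerDensity τ) :
    Measurable (proposalLaw τ) := by
  refine Measure.measurable_of_measurable_coe _ fun s hs => ?_
  simp only [proposalLaw, withDensity_apply _ hs]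
  have h : Measurable (Function.uncurry fun (p : Vec d × Vec M) (z : Vec d) =>
      ENNReal.ofReal (τ z p.1 p.2)) :=
    (hτ.measurable.comp (measurable_snd.prodMk measurable_fst)).ennreal_ofReal
  exact h.lintegral_prod_right'

theorem IsFellerDensity.integral_proposalLaw (hτ : IsFellerDensity τ) (p : Vec d × Vec M)
    (g : Vec d → ℝ) : ∫ z, g z ∂(proposalLaw τ p) = ∫ z, g z * τ z p.1 p.2 := by
  rw [proposalLaw, integral_withDensity_eq_integral_toReal_smul
    (hτ.measurable_left p).ennreal_ofReal (.of_forall fun _ => ENNReal.ofReal_lt_top)]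
  refine integral_congr_ae (.of_forall fun z => ?_)
  simp only [ENNReal.toReal_ofReal (hτ.nonneg _ _ _), smul_eq_mul, mul_comm]

variable (β u) in
/-- The law of the new state, given the old state and the proposal. -/
noncomputable def acceptLaw (q : (Vec d × Vec M) × Vec d) : Measure (Vec d × Vec M) :=
  ENNReal.ofReal (β q.2 (u q.2 q.1.2) q.1.1 (u q.1.1 q.1.2)) • Measure.dirac (q.2, u q.2 q.1.2) +
    ENNReal.ofReal (1 - β q.2 (u q.2 q.1.2) q.1.1 (u q.1.1 q.1.2)) •
      Measure.dirac (q.1.1, u q.1.1 q.1.2)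

theorem IsAcceptance.measurable_comp (hβ : IsAcceptance β)
    (hu : Measurable fun q : Vec d × Vec M => u q.1 q.2) :
    Measurable fun q : (Vec d × Vec M) × Vec d =>
      β q.2 (u q.2 q.1.2) q.1.1 (u q.1.1 q.1.2) :=
  hβ.measurable.comp (measurable_snd.prodMk ((hu.comp (by fun_prop : Measurable fun
    q : (Vec d × Vec M) × Vec d => (q.2, q.1.2))).prodMk ((by fun_prop : Measurable fun
    q : (Vec d × Vec M) × Vec d => q.1.1).prodMk (hu.comp measurable_fst))))

theorem measurable_acceptLaw (hβ : IsAcceptance β)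
    (hu : Measurable fun q : Vec d × Vec M => u q.1 q.2) : Measurable (acceptLaw β u) := by
  have h1 := hβ.measurable_comp hu
  have h2 : Measurable fun q : (Vec d × Vec M) × Vec d => (q.2, u q.2 q.1.2) :=
    measurable_snd.prodMk (hu.comp (by fun_prop : Measurable fun
    q : (Vec d × Vec M) × Vec d => (q.2, q.1.2)))
  have h3 : Measurable fun q : (Vec d × Vec M) × Vec d => (q.1.1, u q.1.1 q.1.2) :=
    (by fun_prop : Measurable fun
    q : (Vec d × Vec M) × Vec d => q.1.1).prodMk (hu.comp measurable_fst)
  refine Measure.measurable_of_measurable_coe _ fun s hs => ?_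
  simp only [acceptLaw, Measure.add_apply, Measure.smul_apply, smul_eq_mul]
  have h4 := (Measure.measurable_coe hs).comp (Measure.measurable_dirac.comp h2)
  have h5 := (Measure.measurable_coe hs).comp (Measure.measurable_dirac.comp h3)
  exact (h1.ennreal_ofReal.mul h4).add ((measurable_const.sub h1).ennreal_ofReal.mul h5)

theorem isProbabilityMeasure_acceptLaw (hβ : IsAcceptance β) (q : (Vec d × Vec M) × Vec d) :
    IsProbabilityMeasure (acceptLaw β u q) := by
  refine ⟨?_⟩
  simp only [acceptLaw, Measure.add_apply, Measure.smul_apply, smul_eq_mul, measure_univ, mul_one]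
  have := hβ.le_one q.2 (u q.2 q.1.2) q.1.1 (u q.1.1 q.1.2)
  rw [← ENNReal.ofReal_add (hβ.nonneg _ _ _ _) (by linarith)]
  simp

theorem measurable_jumpLaw (hτ : IsFellerDensity τ) (hβ : IsAcceptance β)
    (hu : Measurable fun q : Vec d × Vec M => u q.1 q.2) : Measurable (jumpLaw u τ β) := by
  refine Measure.measurable_of_measurable_coe _ fun s hs => ?_
  have ha := measurable_acceptLaw hβ hu
  have h : ∀ p, jumpLaw u τ β p s = ∫⁻ z, acceptLaw β u (p, z) s ∂(proposalLaw τ p) := fun p =>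
    Measure.bind_apply hs (ha.comp measurable_prodMk_left).aemeasurable
  simp only [h]
  let K : ProbabilityTheory.Kernel (Vec d × Vec M) (Vec d) :=
    ⟨proposalLaw τ, hτ.measurable_proposalLaw⟩
  have : ProbabilityTheory.IsMarkovKernel K := ⟨hτ.isProbabilityMeasure⟩
  exact ((Measure.measurable_coe hs).comp ha).lintegral_kernel_prod_right' (κ := K)

theorem isProbabilityMeasure_jumpLaw (hτ : IsFellerDensity τ) (hβ : IsAcceptance β)
    (hu : Measurable fun q : Vec d × Vec M => u q.1 q.2) (p : Vec d × Vec M) :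
    IsProbabilityMeasure (jumpLaw u τ β p) := by
  have := hτ.isProbabilityMeasure p
  refine ⟨?_⟩
  rw [jumpLaw]
  exact (bind_apply_univ ((measurable_acceptLaw hβ hu).comp measurable_prodMk_left)
    fun z => isProbabilityMeasure_acceptLaw hβ (p, z)).trans measure_univ

theorem integral_jumpLaw (hτ : IsFellerDensity τ) (hβ : IsAcceptance β)
    (hu : Measurable fun q : Vec d × Vec M => u q.1 q.2) {φ : Vec d × Vec M → ℝ}
    (hφ : Measurable φ) {B : ℝ} (hB : ∀ p, |φ p| ≤ B) (p : Vec d × Vec M) :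
    ∫ q, φ q ∂(jumpLaw u τ β p) = ∫ z, (β z (u z p.2) p.1 (u p.1 p.2) * φ (z, u z p.2) +
      (1 - β z (u z p.2) p.1 (u p.1 p.2)) * φ (p.1, u p.1 p.2)) ∂(proposalLaw τ p) := by
  have := hτ.isProbabilityMeasure p
  rw [jumpLaw]
  refine (integral_bind_of_bound ((measurable_acceptLaw hβ hu).comp measurable_prodMk_left)
    (fun z => isProbabilityMeasure_acceptLaw hβ (p, z)) hφ hB).trans ?_
  refine integral_congr_ae (.of_forall fun z => ?_)
  have hd : ∀ q, Integrable φ (Measure.dirac q) := fun q =>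
    .of_bound hφ.aestronglyMeasurable B (.of_forall hB)
  simp only [Function.comp_apply, acceptLaw]
  rw [integral_add_measure ((hd _).smul_measure ENNReal.ofReal_ne_top)
    ((hd _).smul_measure ENNReal.ofReal_ne_top), integral_smul_measure, integral_smul_measure,
    integral_dirac, integral_dirac, ENNReal.toReal_ofReal (hβ.nonneg _ _ _ _),
    ENNReal.toReal_ofReal (by linarith [hβ.le_one z (u z p.2) p.1 (u p.1 p.2)])]
  rfl

theorem IsAcceptance.abs_convexComb_le (hβ : IsAcceptance β) {x κ y κ'} {a b B : ℝ}
    (ha : |a| ≤ B) (hb : |b| ≤ B) : |β x κ y κ' * a + (1 - β x κ y κ') * b| ≤ B := by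
  have h0 := hβ.nonneg x κ y κ'
  have h1 := hβ.le_one x κ y κ'
  rw [abs_le] at *
  constructor <;> nlinarith

/-- Joint continuity of one step in the state, the test function, the acceptance probability and
the moment update. -/
theorem tendsto_integral_jumpLaw (hτ : IsFellerDensity τ) {ι : Type*} {l : Filter ι}
    {βs : ι → Vec d → Vec M → Vec d → Vec M → ℝ} (hβs : ∀ᶠ i in l, IsAcceptance (βs i))
    (hβ : IsAcceptance β)
    (hβl : ∀ q : Vec d × Vec M × Vec d × Vec M, Tendsto
      (fun r : ι × (Vec d × Vec M × Vec d × Vec M) => βs r.1 r.2.1 r.2.2.1 r.2.2.2.1 r.2.2.2.2)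
      (l ×ˢ 𝓝 q) (𝓝 (β q.1 q.2.1 q.2.2.1 q.2.2.2)))
    {us : ι → Vec d → Vec M → Vec M}
    (hus : ∀ i, Measurable fun q : Vec d × Vec M => us i q.1 q.2)
    (hu : Measurable fun q : Vec d × Vec M => u q.1 q.2)
    (hul : ∀ q : Vec d × Vec M, Tendsto (fun r : ι × (Vec d × Vec M) => us r.1 r.2.1 r.2.2)
      (l ×ˢ 𝓝 q) (𝓝 (u q.1 q.2)))
    {ψs : ι → Vec d × Vec M → ℝ} {ψ : Vec d × Vec M → ℝ} {B : ℝ}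
    (hψs : ∀ i, Measurable (ψs i)) (hψ : Measurable ψ) (hBs : ∀ i p, |ψs i p| ≤ B)
    (hB : ∀ p, |ψ p| ≤ B)
    (hψl : ∀ p, Tendsto (Function.uncurry ψs) (l ×ˢ 𝓝 p) (𝓝 (ψ p))) (p : Vec d × Vec M) :
    Tendsto (fun r : ι × (Vec d × Vec M) => ∫ q, ψs r.1 q ∂(jumpLaw (us r.1) τ (βs r.1) r.2))
      (l ×ˢ 𝓝 p) (𝓝 (∫ q, ψ q ∂(jumpLaw u τ β p))) := by
  have hev : ∀ᶠ r : ι × (Vec d × Vec M) in l ×ˢ 𝓝 p, IsAcceptance (βs r.1) :=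
    tendsto_fst.eventually hβs
  rw [integral_jumpLaw hτ hβ hu hψ hB]
  have heq : ∀ᶠ r : ι × (Vec d × Vec M) in l ×ˢ 𝓝 p,
      ∫ z, (βs r.1 z (us r.1 z r.2.2) r.2.1 (us r.1 r.2.1 r.2.2) * ψs r.1 (z, us r.1 z r.2.2) +
      (1 - βs r.1 z (us r.1 z r.2.2) r.2.1 (us r.1 r.2.1 r.2.2)) *
        ψs r.1 (r.2.1, us r.1 r.2.1 r.2.2)) ∂(proposalLaw τ r.2) =
      ∫ q, ψs r.1 q ∂(jumpLaw (us r.1) τ (βs r.1) r.2) := by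
    filter_upwards [hev] with r hr
    exact (integral_jumpLaw hτ hr (hus _) (hψs _) (hBs _) _).symm
  refine Tendsto.congr' heq ?_
  have := hτ.isProbabilityMeasure p
  -- The proposal laws converge weakly as the state varies, by the Feller hypothesis, and the
  -- integrand converges jointly in the index, the state and the proposal.
  refine tendsto_integral_of_tendsto_prod_nhds
    (ν := fun r : ι × (Vec d × Vec M) => proposalLaw τ r.2)
    (ψ := fun r z => βs r.1 z (us r.1 z r.2.2) r.2.1 (us r.1 r.2.1 r.2.2) *
      ψs r.1 (z, us r.1 z r.2.2) +
      (1 - βs r.1 z (us r.1 z r.2.2) r.2.1 (us r.1 r.2.1 r.2.2)) *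
        ψs r.1 (r.2.1, us r.1 r.2.1 r.2.2))
    (B := B) ?_ ?_ ?_ ?_ ?_
  · exact .of_forall fun r => have := hτ.isProbabilityMeasure r.2; inferInstance
  · intro g
    simp only [hτ.integral_proposalLaw]
    exact ((hτ.continuous_integral g).tendsto p).comp tendsto_snd
  · filter_upwards [hev] with r hr
    have h1 := (hr.measurable_comp (hus r.1)).comp (measurable_prodMk_left (x := r.2))
    have h2 : Measurable fun z : Vec d => ψs r.1 (z, us r.1 z r.2.2) :=
      (hψs r.1).comp (measurable_id.prodMk ((hus r.1).comp (by fun_prop : Measurable fun z : Vec d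
        => (z, r.2.2))))
    exact (h1.mul h2).add ((measurable_const.sub h1).mul measurable_const)
  · filter_upwards [hev] with r hr z
    exact hr.abs_convexComb_le (hBs _ _) (hBs _ _)
  · intro z
    have ti : Tendsto (fun r : (ι × (Vec d × Vec M)) × Vec d => r.1.1)
        ((l ×ˢ 𝓝 p) ×ˢ 𝓝 z) l := tendsto_fst.comp tendsto_fst
    have tp : Tendsto (fun r : (ι × (Vec d × Vec M)) × Vec d => r.1.2)
        ((l ×ˢ 𝓝 p) ×ˢ 𝓝 z) (𝓝 p) := tendsto_snd.comp tendsto_fst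
    have tz : Tendsto (fun r : (ι × (Vec d × Vec M)) × Vec d => r.2)
        ((l ×ˢ 𝓝 p) ×ˢ 𝓝 z) (𝓝 z) := tendsto_snd
    have ty : Tendsto (fun r : (ι × (Vec d × Vec M)) × Vec d => r.1.2.1)
        ((l ×ˢ 𝓝 p) ×ˢ 𝓝 z) (𝓝 p.1) := (continuous_fst.tendsto p).comp tp
    have tκ : Tendsto (fun r : (ι × (Vec d × Vec M)) × Vec d => r.1.2.2)
        ((l ×ˢ 𝓝 p) ×ˢ 𝓝 z) (𝓝 p.2) := (continuous_snd.tendsto p).comp tp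
    have w1 := (hul (z, p.2)).comp (ti.prodMk (tz.prodMk_nhds tκ))
    have w2 := (hul p).comp (ti.prodMk tp)
    have b := (hβl (z, u z p.2, p.1, u p.1 p.2)).comp
      (ti.prodMk (tz.prodMk_nhds (w1.prodMk_nhds (ty.prodMk_nhds w2))))
    have s1 := (hψl (z, u z p.2)).comp (ti.prodMk (tz.prodMk_nhds w1))
    have s2 := (hψl (p.1, u p.1 p.2)).comp (ti.prodMk (ty.prodMk_nhds w2))
    exact (b.mul s1).add ((b.const_sub 1).mul s2)

end Jump

/-! ### Relaxation of the moments -/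

section Relax

/-- The moments relax towards `Δκ(x)`: the solution at the time `t` of `s κ' = Δκ(x) - κ` which
starts from `κ` at the time `θ t`. -/
def relax (m : Fin M → Fin d → ℕ) (θ : ℝ) (p : Vec d × Vec M) : Vec d × Vec M :=
  (p.1, θ • p.2 + (1 - θ) • momentIncr m p.1)

variable (m : Fin M → Fin d → ℕ)

theorem contDiff_momentIncr : ContDiff ℝ ∞ (momentIncr m : Vec d → Vec M) := by
  unfold momentIncr
  fun_prop

theorem continuous_momentIncr : Continuous (momentIncr m : Vec d → Vec M) :=
  (contDiff_momentIncr m).continuous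

theorem contDiff_relax_uncurry :
    ContDiff ℝ ∞ fun q : ℝ × (Vec d × Vec M) => relax m q.1 q.2 := by
  have := contDiff_momentIncr m
  unfold relax
  fun_prop

theorem contDiff_relax (θ : ℝ) : ContDiff ℝ ∞ (relax m θ : Vec d × Vec M → _) :=
  (contDiff_relax_uncurry m).comp (contDiff_const.prodMk contDiff_id)

theorem continuous_relax_uncurry :
    Continuous fun q : ℝ × (Vec d × Vec M) => relax m q.1 q.2 :=
  (contDiff_relax_uncurry m).continuous

theorem continuous_relax (θ : ℝ) : Continuous (relax m θ : Vec d × Vec M → _) :=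
  (contDiff_relax m θ).continuous

/-- `relax` is a homothety of the `κ`-fibre with centre `Δκ(x)`. Ratios of consecutive times
therefore telescope along a run of steps without jumps. -/
theorem relax_relax (a b : ℝ) (p : Vec d × Vec M) : relax m a (relax m b p) = relax m (a * b) p := by
  ext j
  · rfl
  · simp [relax]; ring

theorem relax_one (p : Vec d × Vec M) : relax m 1 p = p := by simp [relax]

/-- The initial law sits on the fixed points of relaxation, so paths without jumps contribute the
initial law at all times. -/
theorem relax_momentIncr (θ : ℝ) (x : Vec d) :
    relax m θ (x, momentIncr m x) = (x, momentIncr m x) := by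
  ext j
  · rfl
  · simp [relax]

theorem relax_eq_momentUpdate (n : ℕ) (p : Vec d × Vec M) :
    relax m (n / (n + 1)) p = (p.1, momentUpdate m n p.1 p.2) := by
  have : (n : ℝ) + 1 ≠ 0 := by positivity
  ext j
  · rfl
  · simp [relax, momentUpdate]
    field_simp
    ring

theorem measurable_momentUpdate (n : ℕ) :
    Measurable fun q : Vec d × Vec M => momentUpdate m n q.1 q.2 := by
  have := (continuous_momentIncr m).measurable
  unfold momentUpdate
  fun_prop

end Relax

end MMC

namespace MMC

/-! ### Power series with factorially decaying coefficients -/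

section PowerSeries

theorem summable_factorial_smul_pow {a : ℕ → ℝ} {B : ℝ}
    (ha : ∀ j, |a j| ≤ B * (Nat.factorial j : ℝ)⁻¹) (x : ℝ) : Summable fun j => x ^ j * a j := by
  refine .of_norm_bounded (g := fun j => B * (|x| ^ j / (Nat.factorial j : ℝ)))
    ((Real.summable_pow_div_factorial |x|).mul_left B) fun j => ?_
  rw [norm_mul, norm_pow, Real.norm_eq_abs, Real.norm_eq_abs]
  calc |x| ^ j * |a j| ≤ |x| ^ j * (B * (Nat.factorial j : ℝ)⁻¹) := by gcongr; exact ha j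
    _ = _ := by ring

/-- The coefficients of the derived series satisfy the same bound, since `(j + 1) / (j + 1)! = 1 /
j!`. -/
theorem abs_succ_mul_le {a : ℕ → ℝ} {B : ℝ} (ha : ∀ j, |a j| ≤ B * (Nat.factorial j : ℝ)⁻¹)
    (j : ℕ) : |((j : ℝ) + 1) * a (j + 1)| ≤ B * (Nat.factorial j : ℝ)⁻¹ := by
  rw [abs_mul, abs_of_nonneg (by positivity : (0 : ℝ) ≤ j + 1)]
  calc ((j : ℝ) + 1) * |a (j + 1)|
      ≤ ((j : ℝ) + 1) * (B * (Nat.factorial (j + 1) : ℝ)⁻¹) := by gcongr; exact ha _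
    _ = _ := by
      rw [Nat.factorial_succ]
      push_cast
      field_simp

/-- Termwise differentiation on the ball of radius `|x| + 1`, where the derived terms have a
summable majorant. -/
theorem hasDerivAt_tsum_pow_mul {a : ℕ → ℝ} {B : ℝ}
    (ha : ∀ j, |a j| ≤ B * (Nat.factorial j : ℝ)⁻¹) (x : ℝ) :
    HasDerivAt (fun y => ∑' j, y ^ j * a j) (∑' j : ℕ, x ^ j * (((j : ℝ) + 1) * a (j + 1))) x := by
  have hB : 0 ≤ B := by simpa using (abs_nonneg _).trans (ha 0)
  set R : ℝ := |x| + 1 with hR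
  have hsum : Summable fun j : ℕ => (j : ℝ) * R ^ (j - 1) * (B * (Nat.factorial j : ℝ)⁻¹) := by
    rw [← summable_nat_add_iff 1]
    refine ((Real.summable_pow_div_factorial R).mul_left B).congr fun j => ?_
    rw [Nat.factorial_succ]
    push_cast
    field_simp
  have hx : x ∈ Metric.ball (0 : ℝ) R := by simp [hR]
  have h := hasDerivAt_tsum_of_isPreconnected (g := fun (j : ℕ) (y : ℝ) => y ^ j * a j)
    (g' := fun j y => (j : ℝ) * y ^ (j - 1) * a j) hsum Metric.isOpen_ball
    (convex_ball (0 : ℝ) R).isPreconnected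
    (fun j y _ => (hasDerivAt_pow j y).mul_const (a j)) (fun j y hy => ?_) hx
    (summable_factorial_smul_pow ha x) hx
  · have hs : Summable fun j : ℕ => (j : ℝ) * x ^ (j - 1) * a j := by
      rw [← summable_nat_add_iff 1]
      refine (summable_factorial_smul_pow (abs_succ_mul_le ha) x).congr fun j => ?_
      push_cast
      ring
    rw [hs.tsum_eq_zero_add] at h
    refine HasDerivAt.congr_deriv h ?_
    simp only [Nat.cast_zero, zero_mul, zero_add]
    refine tsum_congr fun j => ?_
    push_cast
    ring
  · rw [norm_mul, norm_mul, norm_pow, Real.norm_eq_abs, Real.norm_eq_abs, Real.norm_eq_abs,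
      Nat.abs_cast]
    rw [mem_ball_zero_iff, Real.norm_eq_abs] at hy
    have := ha j
    gcongr

end PowerSeries

/-! ### The Poisson mixture and its equation -/

variable {d M : ℕ} (m : Fin M → Fin d → ℕ) (τ : Vec d → Vec d → Vec M → ℝ)
  (β : Vec d → Vec M → Vec d → Vec M → ℝ) (ρ : Measure (Vec d))

/-- The law of `(x, Δκ(x))` for `x` with law `ρ`. -/
noncomputable def initialLaw : Measure (Vec d × Vec M) := ρ.map fun x => (x, momentIncr m x)

/-- The jump law of the limiting process: the moments do not change at a jump. -/
noncomputable abbrev limitJump : Vec d × Vec M → Measure (Vec d × Vec M) :=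
  jumpLaw (fun _ κ => κ) τ β

/-- The measure `θ ^ j dθ` on `(0, 1]`. -/
noncomputable def timeWeight (j : ℕ) : Measure ℝ :=
  (volume.restrict (Set.Ioc 0 1)).withDensity fun θ => ENNReal.ofReal (θ ^ j)

/-- The unnormalised contribution of the paths with `j` jumps to the solution. -/
noncomputable def jumpPart : ℕ → Measure (Vec d × Vec M)
  | 0 => initialLaw m ρ
  | j + 1 => (((jumpPart j).bind (limitJump τ β)).prod (timeWeight j)).map
      fun q => relax m q.2 q.1

/-- The solution of the limit equation, a Poisson mixture of the contributions of the paths with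
a given number of jumps. -/
noncomputable def kineticFlow (L : ℝ) (t : ℝ) : Measure (Vec d × Vec M) :=
  Measure.sum fun j => ENNReal.ofReal (Real.exp (-(L * t)) * (L * t) ^ j) • jumpPart m τ β ρ j

/-- The generator `∇_κ φ · (Δκ - κ)` of the relaxation of the moments. -/
noncomputable def relaxGen (φ : Vec d × Vec M → ℝ) (p : Vec d × Vec M) : ℝ :=
  fderiv ℝ φ p (0, momentIncr m p.1 - p.2)

theorem timeWeight_univ (j : ℕ) : timeWeight j Set.univ = ENNReal.ofReal ((j : ℝ) + 1)⁻¹ := by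
  have hi : IntegrableOn (fun θ : ℝ => θ ^ j) (Set.Ioc 0 1) :=
    ((continuous_pow j).integrableOn_Icc (a := 0) (b := 1)).mono_set Set.Ioc_subset_Icc_self
  rw [timeWeight, withDensity_apply _ .univ, Measure.restrict_univ,
    ← ofReal_integral_eq_lintegral_ofReal hi]
  · rw [← intervalIntegral.integral_of_le zero_le_one, integral_pow]
    simp
  · exact (ae_restrict_mem measurableSet_Ioc).mono fun θ hθ => pow_nonneg hθ.1.le j

instance isFiniteMeasure_timeWeight (j : ℕ) : IsFiniteMeasure (timeWeight j) :=
  ⟨by rw [timeWeight_univ]; exact ENNReal.ofReal_lt_top⟩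

theorem integral_timeWeight (j : ℕ) (g : ℝ → ℝ) :
    ∫ θ, g θ ∂(timeWeight j) = ∫ θ in (0 : ℝ)..1, θ ^ j * g θ := by
  rw [timeWeight, integral_withDensity_eq_integral_toReal_smul (by fun_prop)
    (.of_forall fun _ => ENNReal.ofReal_lt_top), intervalIntegral.integral_of_le zero_le_one]
  refine setIntegral_congr_fun measurableSet_Ioc fun θ hθ => ?_
  simp only [smul_eq_mul]
  rw [ENNReal.toReal_ofReal (pow_nonneg hθ.1.le j)]

theorem measurable_initialMap : Measurable fun x : Vec d => (x, momentIncr m x) :=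
  measurable_id.prodMk (continuous_momentIncr m).measurable

instance isProbabilityMeasure_initialLaw [IsProbabilityMeasure ρ] :
    IsProbabilityMeasure (initialLaw m ρ) :=
  Measure.isProbabilityMeasure_map (measurable_initialMap m).aemeasurable

theorem integral_initialLaw {φ : Vec d × Vec M → ℝ} (hφ : Measurable φ) :
    ∫ p, φ p ∂(initialLaw m ρ) = ∫ x, φ (x, momentIncr m x) ∂ρ :=
  integral_map (measurable_initialMap m).aemeasurable hφ.aestronglyMeasurable

theorem measurable_relax_uncurry :
    Measurable fun q : (Vec d × Vec M) × ℝ => relax m q.2 q.1 :=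
  ((continuous_relax_uncurry m).comp continuous_swap).measurable

variable {τ β}

theorem isProbabilityMeasure_limitJump (hτ : IsFellerDensity τ) (hβ : IsAcceptance β)
    (p : Vec d × Vec M) : IsProbabilityMeasure (limitJump τ β p) :=
  isProbabilityMeasure_jumpLaw hτ hβ measurable_snd p

theorem measurable_limitJump (hτ : IsFellerDensity τ) (hβ : IsAcceptance β) :
    Measurable (limitJump τ β) :=
  measurable_jumpLaw hτ hβ measurable_snd

/-- Each level multiplies the mass by that of `θ ^ j dθ`, which is `1 / (j + 1)`. These are the
factorials that make the exponential weights of `kineticFlow` sum to one. -/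
theorem jumpPart_univ (hτ : IsFellerDensity τ) (hβ : IsAcceptance β) [IsProbabilityMeasure ρ]
    (j : ℕ) : jumpPart m τ β ρ j Set.univ = ENNReal.ofReal (Nat.factorial j : ℝ)⁻¹ := by
  induction j with
  | zero => simp [jumpPart]
  | succ j ih =>
    rw [jumpPart, Measure.map_apply (measurable_relax_uncurry m) .univ, Set.preimage_univ,
      ← Set.univ_prod_univ, Measure.prod_prod, timeWeight_univ,
      bind_apply_univ (measurable_limitJump hτ hβ) (isProbabilityMeasure_limitJump hτ hβ), ih,
      ← ENNReal.ofReal_mul (by positivity), Nat.factorial_succ]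
    congr 1
    push_cast
    rw [mul_inv, mul_comm]

theorem isFiniteMeasure_jumpPart (hτ : IsFellerDensity τ) (hβ : IsAcceptance β)
    [IsProbabilityMeasure ρ] (j : ℕ) : IsFiniteMeasure (jumpPart m τ β ρ j) :=
  ⟨by rw [jumpPart_univ m ρ hτ hβ]; exact ENNReal.ofReal_lt_top⟩

theorem abs_integral_jumpPart_le (hτ : IsFellerDensity τ) (hβ : IsAcceptance β)
    [IsProbabilityMeasure ρ] (j : ℕ) {φ : Vec d × Vec M → ℝ} {B : ℝ} (hB : ∀ p, |φ p| ≤ B) :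
    |∫ p, φ p ∂(jumpPart m τ β ρ j)| ≤ B * (Nat.factorial j : ℝ)⁻¹ := by
  have := isFiniteMeasure_jumpPart m ρ hτ hβ j
  refine (norm_integral_le_of_norm_le_const (f := φ) (.of_forall hB)).trans ?_
  rw [measureReal_def, jumpPart_univ m ρ hτ hβ, ENNReal.toReal_ofReal (by positivity)]

theorem integrable_jumpPart_bind_prod (hτ : IsFellerDensity τ) (hβ : IsAcceptance β)
    [IsProbabilityMeasure ρ] (j : ℕ) {φ : Vec d × Vec M → ℝ} (hφ : Measurable φ) {B : ℝ}
    (hB : ∀ p, |φ p| ≤ B) :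
    Integrable (fun q : (Vec d × Vec M) × ℝ => φ (relax m q.2 q.1))
      (((jumpPart m τ β ρ j).bind (limitJump τ β)).prod (timeWeight j)) := by
  have := isFiniteMeasure_jumpPart m ρ hτ hβ j
  have := isFiniteMeasure_bind (μ := jumpPart m τ β ρ j) (measurable_limitJump hτ hβ)
    (isProbabilityMeasure_limitJump hτ hβ)
  exact .of_bound (hφ.comp (measurable_relax_uncurry m)).aestronglyMeasurable B
    (.of_forall fun q => hB _)

theorem integral_jumpPart_succ (hτ : IsFellerDensity τ) (hβ : IsAcceptance β)
    [IsProbabilityMeasure ρ] (j : ℕ) {φ : Vec d × Vec M → ℝ} (hφ : Measurable φ) {B : ℝ}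
    (hB : ∀ p, |φ p| ≤ B) :
    ∫ p, φ p ∂(jumpPart m τ β ρ (j + 1)) =
      ∫ p, (∫ θ in (0 : ℝ)..1, θ ^ j * φ (relax m θ p))
        ∂((jumpPart m τ β ρ j).bind (limitJump τ β)) := by
  have := isFiniteMeasure_jumpPart m ρ hτ hβ j
  have := isFiniteMeasure_bind (μ := jumpPart m τ β ρ j) (measurable_limitJump hτ hβ)
    (isProbabilityMeasure_limitJump hτ hβ)
  rw [jumpPart, integral_map (measurable_relax_uncurry m).aemeasurable hφ.aestronglyMeasurable,
    integral_prod _ (integrable_jumpPart_bind_prod m ρ hτ hβ j hφ hB)]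
  simp only [integral_timeWeight]

/-- The same integral with `θ` outermost, the form in which the Riemann sums of the chain converge;
the other order serves the integration by parts along each path. -/
theorem integral_jumpPart_succ' (hτ : IsFellerDensity τ) (hβ : IsAcceptance β)
    [IsProbabilityMeasure ρ] (j : ℕ) {φ : Vec d × Vec M → ℝ} (hφ : Measurable φ) {B : ℝ}
    (hB : ∀ p, |φ p| ≤ B) :
    ∫ p, φ p ∂(jumpPart m τ β ρ (j + 1)) =
      ∫ θ in (0 : ℝ)..1, θ ^ j *
        ∫ p, ∫ q, φ (relax m θ q) ∂(limitJump τ β p) ∂(jumpPart m τ β ρ j) := by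
  have := isFiniteMeasure_jumpPart m ρ hτ hβ j
  have := isFiniteMeasure_bind (μ := jumpPart m τ β ρ j) (measurable_limitJump hτ hβ)
    (isProbabilityMeasure_limitJump hτ hβ)
  rw [jumpPart, integral_map (measurable_relax_uncurry m).aemeasurable hφ.aestronglyMeasurable,
    integral_prod_symm _ (integrable_jumpPart_bind_prod m ρ hτ hβ j hφ hB), integral_timeWeight]
  refine intervalIntegral.integral_congr fun θ _ => ?_
  simp only
  rw [integral_bind_of_bound (measurable_limitJump hτ hβ) (isProbabilityMeasure_limitJump hτ hβ)
    (f := fun q => φ (relax m θ q)) (hφ.comp (continuous_relax m θ).measurable) fun q => hB _]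

/-- A bound for a test function and for `∇_κ φ · (Δκ - κ)`. -/
theorem exists_bound_testFunction {φ : Vec d × Vec M → ℝ} (hφ : ContDiff ℝ ∞ φ)
    (hc : HasCompactSupport φ) :
    ∃ B, (∀ p, |φ p| ≤ B) ∧ ∀ p, |relaxGen m φ p| ≤ B := by
  obtain ⟨B1, h1⟩ := hc.exists_bound_of_continuous hφ.continuous
  have hgc : Continuous (relaxGen m φ) :=
    (hφ.continuous_fderiv (by simp)).clm_apply
      (continuous_const.prodMk (((continuous_momentIncr m).comp continuous_fst).sub continuous_snd))
  -- The drift `Δκ - κ` is unbounded, but it is multiplied by the derivative of `φ`, which vanishes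
  -- off the support of `φ`.
  have hgs : HasCompactSupport (relaxGen m φ) :=
    (hc.fderiv ℝ).mono' (fun p hp => subset_tsupport _ (by
      contrapose! hp
      simp only [Function.mem_support, not_not] at hp ⊢
      simp [relaxGen, hp]))
  obtain ⟨B2, h2⟩ := hgs.exists_bound_of_continuous hgc
  exact ⟨max B1 B2, fun p => (h1 p).trans (le_max_left _ _), fun p => (h2 p).trans (le_max_right _ _)⟩

theorem continuous_relaxGen {φ : Vec d × Vec M → ℝ} (hφ : ContDiff ℝ ∞ φ) :
    Continuous (relaxGen m φ) :=
  (hφ.continuous_fderiv (by simp)).clm_apply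
    (continuous_const.prodMk (((continuous_momentIncr m).comp continuous_fst).sub continuous_snd))

theorem hasDerivAt_relax (θ : ℝ) (p : Vec d × Vec M) :
    HasDerivAt (fun t => relax m t p) ((0, p.2 - momentIncr m p.1) : Vec d × Vec M) θ := by
  refine (hasDerivAt_const θ p.1).prodMk ?_
  have h := ((hasDerivAt_id θ).smul_const p.2).add
    (((hasDerivAt_id θ).const_sub 1).smul_const (momentIncr m p.1))
  exact h.congr_deriv (by simp [sub_eq_add_neg])

/-- Along the flow the generator acts as `-θ d/dθ`, so this is integration by parts for `θ ^ (j + 1)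
φ(relax m θ p)`. The boundary term at `0` vanishes and the one at `1` is `φ p`. -/
theorem integral_pow_mul_relaxGen {φ : Vec d × Vec M → ℝ} (hφ : ContDiff ℝ ∞ φ) (j : ℕ)
    (p : Vec d × Vec M) :
    ∫ θ in (0 : ℝ)..1, θ ^ j * relaxGen m φ (relax m θ p) =
      ((j : ℝ) + 1) * (∫ θ in (0 : ℝ)..1, θ ^ j * φ (relax m θ p)) - φ p := by
  have hr : Continuous fun θ : ℝ => relax m θ p :=
    (continuous_relax_uncurry m).comp (continuous_id.prodMk continuous_const)
  have c1 : Continuous fun θ : ℝ => θ ^ j * relaxGen m φ (relax m θ p) :=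
    (continuous_pow j).mul ((continuous_relaxGen m hφ).comp hr)
  have c2 : Continuous fun θ : ℝ => ((j : ℝ) + 1) * (θ ^ j * φ (relax m θ p)) :=
    continuous_const.mul ((continuous_pow j).mul (hφ.continuous.comp hr))
  have hd : ∀ θ ∈ Set.uIcc (0 : ℝ) 1, HasDerivAt (fun θ => θ ^ (j + 1) * φ (relax m θ p))
      (((j : ℝ) + 1) * (θ ^ j * φ (relax m θ p)) - θ ^ j * relaxGen m φ (relax m θ p)) θ := by
    intro θ _
    have h1 := ((hφ.differentiable (by simp)) (relax m θ p)).hasFDerivAt.comp_hasDerivAt θ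
      (hasDerivAt_relax m θ p)
    have h2 := (hasDerivAt_pow (j + 1) θ).mul h1
    refine h2.congr_deriv ?_
    have h3 : ((0, momentIncr m (relax m θ p).1 - (relax m θ p).2) : Vec d × Vec M) =
        (-θ) • (0, p.2 - momentIncr m p.1) := by
      ext i
      · simp
      · simp [relax]; ring
    have h4 : relaxGen m φ (relax m θ p) =
        -θ * fderiv ℝ φ (relax m θ p) (0, p.2 - momentIncr m p.1) := by
      rw [← smul_eq_mul, ← map_smul, ← h3]
      rfl
    rw [h4]
    push_cast
    simp only [Function.comp_apply]
    ring
  have h := intervalIntegral.integral_eq_sub_of_hasDerivAt hd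
    ((c2.sub c1).intervalIntegrable 0 1)
  rw [intervalIntegral.integral_sub (c2.intervalIntegrable 0 1) (c1.intervalIntegrable 0 1),
    intervalIntegral.integral_const_mul] at h
  simp only [one_pow, one_mul, relax_one, ne_eq, Nat.add_eq_zero_iff, one_ne_zero, and_false,
    not_false_eq_true, zero_pow, zero_mul, sub_zero] at h
  linarith

/-- The balance at level `j + 1`: the boundary term of the integration by parts is the inflow by one
jump from level `j`. -/
theorem integral_relaxGen_jumpPart_succ (hτ : IsFellerDensity τ) (hβ : IsAcceptance β)
    [IsProbabilityMeasure ρ] (j : ℕ) {φ : Vec d × Vec M → ℝ} (hφ : ContDiff ℝ ∞ φ)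
    (hc : HasCompactSupport φ) :
    ∫ p, relaxGen m φ p ∂(jumpPart m τ β ρ (j + 1)) =
      ((j : ℝ) + 1) * ∫ p, φ p ∂(jumpPart m τ β ρ (j + 1)) -
        ∫ p, ∫ q, φ q ∂(limitJump τ β p) ∂(jumpPart m τ β ρ j) := by
  obtain ⟨B, hB1, hB2⟩ := exists_bound_testFunction m hφ hc
  have := isFiniteMeasure_jumpPart m ρ hτ hβ j
  have := isFiniteMeasure_bind (μ := jumpPart m τ β ρ j) (measurable_limitJump hτ hβ)
    (isProbabilityMeasure_limitJump hτ hβ)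
  have hi := (integrable_jumpPart_bind_prod m ρ hτ hβ j hφ.continuous.measurable
    hB1).integral_prod_left
  simp only [integral_timeWeight] at hi
  rw [integral_jumpPart_succ m ρ hτ hβ j (continuous_relaxGen m hφ).measurable hB2,
    integral_jumpPart_succ m ρ hτ hβ j hφ.continuous.measurable hB1]
  simp only [integral_pow_mul_relaxGen m hφ]
  rw [integral_sub (hi.const_mul _) (integrable_of_continuous_of_bound _ hφ.continuous hB1),
    integral_const_mul, integral_bind_of_bound (measurable_limitJump hτ hβ)
      (isProbabilityMeasure_limitJump hτ hβ) hφ.continuous.measurable hB1]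

theorem integral_relaxGen_initialLaw {φ : Vec d × Vec M → ℝ} (hφ : ContDiff ℝ ∞ φ) :
    ∫ p, relaxGen m φ p ∂(initialLaw m ρ) = 0 := by
  rw [integral_initialLaw m ρ (continuous_relaxGen m hφ).measurable]
  simp [relaxGen, ← Prod.zero_eq_mk]

theorem isProbabilityMeasure_kineticFlow (hτ : IsFellerDensity τ) (hβ : IsAcceptance β)
    [IsProbabilityMeasure ρ] {L t : ℝ} (hL : 0 ≤ L) (ht : 0 ≤ t) :
    IsProbabilityMeasure (kineticFlow m τ β ρ L t) := by
  have hLt : 0 ≤ L * t := mul_nonneg hL ht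
  refine ⟨?_⟩
  rw [kineticFlow, Measure.sum_apply _ .univ]
  simp only [Measure.smul_apply, smul_eq_mul, jumpPart_univ m ρ hτ hβ]
  have h : ∀ j : ℕ, ENNReal.ofReal (Real.exp (-(L * t)) * (L * t) ^ j) *
      ENNReal.ofReal (Nat.factorial j : ℝ)⁻¹ =
      ENNReal.ofReal (Real.exp (-(L * t)) * ((L * t) ^ j / (Nat.factorial j : ℝ))) := by
    intro j
    rw [← ENNReal.ofReal_mul (by positivity), mul_assoc, div_eq_mul_inv]
  simp only [h]
  rw [← ENNReal.ofReal_tsum_of_nonneg (fun j => by positivity)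
    ((Real.summable_pow_div_factorial _).mul_left _), tsum_mul_left]
  have : ∑' j : ℕ, (L * t) ^ j / (Nat.factorial j : ℝ) = Real.exp (L * t) := by
    rw [Real.exp_eq_exp_ℝ, NormedSpace.exp_eq_tsum_div]
  rw [this, ← Real.exp_add]
  simp

theorem hasSum_integral_kineticFlow (hτ : IsFellerDensity τ) (hβ : IsAcceptance β)
    [IsProbabilityMeasure ρ] {L t : ℝ} (hL : 0 ≤ L) (ht : 0 ≤ t) {φ : Vec d × Vec M → ℝ}
    (hφ : Measurable φ) {B : ℝ} (hB : ∀ p, |φ p| ≤ B) :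
    HasSum (fun j => Real.exp (-(L * t)) * ((L * t) ^ j * ∫ p, φ p ∂(jumpPart m τ β ρ j)))
      (∫ p, φ p ∂(kineticFlow m τ β ρ L t)) := by
  have hLt : 0 ≤ L * t := mul_nonneg hL ht
  have := isProbabilityMeasure_kineticFlow m ρ hτ hβ hL ht
  have hi : Integrable φ (kineticFlow m τ β ρ L t) :=
    .of_bound hφ.aestronglyMeasurable B (.of_forall hB)
  refine (hasSum_integral_measure hi).congr_fun ?_
  intro j
  rw [integral_smul_measure, ENNReal.toReal_ofReal (by positivity), smul_eq_mul, mul_assoc]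

theorem integral_kineticFlow (hτ : IsFellerDensity τ) (hβ : IsAcceptance β)
    [IsProbabilityMeasure ρ] {L t : ℝ} (hL : 0 ≤ L) (ht : 0 ≤ t) {φ : Vec d × Vec M → ℝ}
    (hφ : Measurable φ) {B : ℝ} (hB : ∀ p, |φ p| ≤ B) :
    ∫ p, φ p ∂(kineticFlow m τ β ρ L t) =
      Real.exp (-(L * t)) * ∑' j, (L * t) ^ j * ∫ p, φ p ∂(jumpPart m τ β ρ j) := by
  rw [← tsum_mul_left, (hasSum_integral_kineticFlow m ρ hτ hβ hL ht hφ hB).tsum_eq]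

variable {α : Vec d → Vec M → Vec d → Vec M → ℝ}

/-- Uniformisation of the jump operator: jumping at the rate `K` amounts to attempting jumps at the
constant rate `L` and accepting with probability `β`, because rejected attempts cancel against `φ
p`. -/
theorem integral_mul_kineticKernel_sub (hτ : IsFellerDensity τ) {L : ℝ}
    (hβ : IsAcceptance β) (hα : ∀ x κ y κ', α x κ y κ' = L * β x κ y κ') {φ : Vec d × Vec M → ℝ}
    (hφ : Measurable φ) {B : ℝ} (hB : ∀ p, |φ p| ≤ B) (p : Vec d × Vec M) :
    (∫ x, φ (x, p.2) * kineticKernel τ α x p.1 p.2) -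
        φ p * ∫ x, kineticKernel τ α x p.1 p.2 =
      L * ((∫ q, φ q ∂(limitJump τ β p)) - φ p) := by
  have := hτ.isProbabilityMeasure p
  have hb : Measurable fun z : Vec d => β z p.2 p.1 p.2 :=
    hβ.measurable.comp (measurable_id.prodMk (measurable_const (a := (p.2, p.1, p.2))))
  have hb1 : ∀ z, |β z p.2 p.1 p.2| ≤ 1 := fun z => by
    rw [abs_of_nonneg (hβ.nonneg _ _ _ _)]; exact hβ.le_one _ _ _ _
  have i1 : Integrable (fun z => β z p.2 p.1 p.2) (proposalLaw τ p) :=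
    .of_bound hb.aestronglyMeasurable 1 (.of_forall hb1)
  have i2 : Integrable (fun z => β z p.2 p.1 p.2 * φ (z, p.2)) (proposalLaw τ p) := by
    refine .of_bound (hb.mul (hφ.comp (measurable_id.prodMk
      measurable_const))).aestronglyMeasurable B (.of_forall fun z => ?_)
    rw [norm_mul]
    calc _ ≤ 1 * B := mul_le_mul (hb1 z) (hB _) (abs_nonneg _) zero_le_one
      _ = B := one_mul B
  have i3 : Integrable (fun z => 1 - β z p.2 p.1 p.2) (proposalLaw τ p) :=
    (integrable_const 1).sub i1
  have e1 : ∫ x, φ (x, p.2) * kineticKernel τ α x p.1 p.2 =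
      L * ∫ z, β z p.2 p.1 p.2 * φ (z, p.2) ∂(proposalLaw τ p) := by
    rw [hτ.integral_proposalLaw, ← integral_const_mul]
    refine integral_congr_ae (.of_forall fun z => ?_)
    simp only [kineticKernel, hα]
    ring
  have e2 : ∫ x, kineticKernel τ α x p.1 p.2 = L * ∫ z, β z p.2 p.1 p.2 ∂(proposalLaw τ p) := by
    rw [hτ.integral_proposalLaw, ← integral_const_mul]
    refine integral_congr_ae (.of_forall fun z => ?_)
    simp only [kineticKernel, hα]
    ring
  rw [e1, e2, integral_jumpLaw hτ hβ measurable_snd hφ hB]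
  have e3 : ∫ z, (β z p.2 p.1 p.2 * φ (z, p.2) + (1 - β z p.2 p.1 p.2) * φ (p.1, p.2))
      ∂(proposalLaw τ p) = (∫ z, β z p.2 p.1 p.2 * φ (z, p.2) ∂(proposalLaw τ p)) +
        (1 - ∫ z, β z p.2 p.1 p.2 ∂(proposalLaw τ p)) * φ p := by
    rw [integral_add i2 (i3.mul_const _), integral_mul_const,
      integral_sub (integrable_const 1) i1]
    simp
  rw [e3]
  ring

theorem fderiv_momentDrift (φ : Vec d × Vec M → ℝ) (p : Vec d × Vec M) (s : ℝ) :
    fderiv ℝ φ p (0, momentDrift m p.1 p.2 s) = s⁻¹ * relaxGen m φ p := by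
  have : ((0, momentDrift m p.1 p.2 s) : Vec d × Vec M) =
      s⁻¹ • ((0, momentIncr m p.1 - p.2) : Vec d × Vec M) := by
    simp [momentDrift]
  rw [this, map_smul, relaxGen, smul_eq_mul]

theorem measurable_integral_limitJump (hτ : IsFellerDensity τ) (hβ : IsAcceptance β)
    {φ : Vec d × Vec M → ℝ} (hφ : Measurable φ) :
    Measurable fun p => ∫ q, φ q ∂(limitJump τ β p) :=
  measurable_integral_of_measurable (measurable_limitJump hτ hβ)
    (isProbabilityMeasure_limitJump hτ hβ) hφ

theorem abs_integral_limitJump_le (hτ : IsFellerDensity τ) (hβ : IsAcceptance β)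
    {φ : Vec d × Vec M → ℝ} {B : ℝ} (hB : ∀ p, |φ p| ≤ B) (p : Vec d × Vec M) :
    |∫ q, φ q ∂(limitJump τ β p)| ≤ B := by
  have := isProbabilityMeasure_limitJump hτ hβ p
  exact abs_integral_le_of_bound hB

/-- Integrals against the flow have the form `exp (-x) F(x)` with `x = L s` and `F` a power series,
so their derivative in `s` is `L exp (-x) (F' - F)`. The generator side is matched to it by the
level balances. -/
theorem isKineticSolution_kineticFlow (hτ : IsFellerDensity τ) {L : ℝ} (hL : 0 < L)
    (hβ : IsAcceptance β) (hα : ∀ x κ y κ', α x κ y κ' = L * β x κ y κ')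
    [IsProbabilityMeasure ρ] : IsKineticSolution m τ α ρ (kineticFlow m τ β ρ L) := by
  have hderiv : ∀ (a : ℕ → ℝ) (B : ℝ), (∀ j, |a j| ≤ B * (Nat.factorial j : ℝ)⁻¹) → ∀ s : ℝ,
      HasDerivAt (fun t => Real.exp (-(L * t)) * ∑' j, (L * t) ^ j * a j)
        (L * (Real.exp (-(L * s)) * ∑' j : ℕ, (L * s) ^ j * (((j : ℝ) + 1) * a (j + 1))) -
          L * (Real.exp (-(L * s)) * ∑' j, (L * s) ^ j * a j)) s := by
    intro a B ha s
    have h0 : HasDerivAt (fun t => L * t) L s := by simpa using (hasDerivAt_id s).const_mul L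
    have h1 := h0.neg.exp.mul ((hasDerivAt_tsum_pow_mul ha (L * s)).comp s h0)
    refine h1.congr_deriv ?_
    simp only [Function.comp_apply, Pi.neg_apply]
    ring
  refine ⟨fun s hs => isProbabilityMeasure_kineticFlow m ρ hτ hβ hL.le hs.le, fun φ => ?_,
    fun φ hφ hc s hs => ?_⟩
  · have hB : ∀ p, |φ p| ≤ ‖φ‖ := φ.norm_coe_le_norm
    have hd := (hderiv _ _ (fun j => abs_integral_jumpPart_le m ρ hτ hβ j hB) 0).continuousAt
    have h0 : Real.exp (-(L * 0)) * ∑' j, (L * 0) ^ j * ∫ p, φ p ∂(jumpPart m τ β ρ j) =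
        ∫ x, φ (x, momentIncr m x) ∂ρ := by
      rw [tsum_eq_single 0 fun j hj => by simp [hj]]
      simp [jumpPart, integral_initialLaw m ρ φ.continuous.measurable]
    have ht : Tendsto (fun t => Real.exp (-(L * t)) *
        ∑' j, (L * t) ^ j * ∫ p, φ p ∂(jumpPart m τ β ρ j)) (𝓝[>] 0)
        (𝓝 (∫ x, φ (x, momentIncr m x) ∂ρ)) := by
      rw [← h0]
      exact hd.tendsto.mono_left nhdsWithin_le_nhds
    refine ht.congr' ?_
    filter_upwards [self_mem_nhdsWithin] with t ht
    exact (integral_kineticFlow m ρ hτ hβ hL.le (le_of_lt ht) φ.continuous.measurable hB).symm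
  · obtain ⟨B, hB1, hB2⟩ := exists_bound_testFunction m hφ hc
    have hm := hφ.continuous.measurable
    have hb := fun j => abs_integral_jumpPart_le m ρ hτ hβ j hB1
    have hQm := measurable_integral_limitJump hτ hβ hm
    have hQB := abs_integral_limitJump_le hτ hβ hB1
    have hLs : L * s ≠ 0 := by positivity
    refine ((hderiv _ _ hb s).congr_deriv ?_).congr_of_eventuallyEq ?_
    · have := isProbabilityMeasure_kineticFlow m ρ hτ hβ hL.le hs.le
      have j1 : Integrable (relaxGen m φ) (kineticFlow m τ β ρ L s) :=
        integrable_of_continuous_of_bound _ (continuous_relaxGen m hφ) hB2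
      have j2 : Integrable (fun p => ∫ q, φ q ∂(limitJump τ β p)) (kineticFlow m τ β ρ L s) :=
        .of_bound hQm.aestronglyMeasurable B (.of_forall hQB)
      have j3 : Integrable φ (kineticFlow m τ β ρ L s) :=
        integrable_of_continuous_of_bound _ hφ.continuous hB1
      have j4 : Integrable (fun p => (∫ q, φ q ∂(limitJump τ β p)) - φ p)
          (kineticFlow m τ β ρ L s) := j2.sub j3
      have e : ∀ p, fderiv ℝ φ p (0, momentDrift m p.1 p.2 s)
          + (∫ x, φ (x, p.2) * kineticKernel τ α x p.1 p.2)
          - φ p * ∫ x, kineticKernel τ α x p.1 p.2 =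
          s⁻¹ * relaxGen m φ p + L * ((∫ q, φ q ∂(limitJump τ β p)) - φ p) := fun p => by
        rw [add_sub_assoc, integral_mul_kineticKernel_sub hτ hβ hα hm hB1, fderiv_momentDrift]
      simp only [e]
      rw [integral_add (j1.const_mul _) (j4.const_mul _), integral_const_mul,
        integral_const_mul, integral_sub j2 j3,
        integral_kineticFlow m ρ hτ hβ hL.le hs.le (continuous_relaxGen m hφ).measurable hB2,
        integral_kineticFlow m ρ hτ hβ hL.le hs.le hQm hQB,
        integral_kineticFlow m ρ hτ hβ hL.le hs.le hm hB1]
      have s1 := summable_factorial_smul_pow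
        (fun j => abs_integral_jumpPart_le m ρ hτ hβ j hB2) (L * s)
      have s2 := summable_factorial_smul_pow
        (fun j => abs_integral_jumpPart_le m ρ hτ hβ j hQB) (L * s)
      have s3 := summable_factorial_smul_pow (abs_succ_mul_le hb) (L * s)
      -- The level-zero term vanishes because the drift is zero on the initial law; the factor `L *
      -- s` thus freed cancels the singular `s⁻¹` of the drift.
      have key : ∑' j, (L * s) ^ j * ∫ p, relaxGen m φ p ∂(jumpPart m τ β ρ j) =
          (L * s) * ((∑' j : ℕ, (L * s) ^ j *
              (((j : ℝ) + 1) * ∫ p, φ p ∂(jumpPart m τ β ρ (j + 1)))) -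
            ∑' j, (L * s) ^ j * ∫ p, ∫ q, φ q ∂(limitJump τ β p) ∂(jumpPart m τ β ρ j)) := by
        rw [s1.tsum_eq_zero_add, ← s3.tsum_sub s2, ← tsum_mul_left, jumpPart,
          integral_relaxGen_initialLaw m ρ hφ, mul_zero, zero_add]
        refine tsum_congr fun j => ?_
        rw [integral_relaxGen_jumpPart_succ m ρ hτ hβ j hφ hc]
        ring
      rw [key]
      field_simp
      ring
    · filter_upwards [lt_mem_nhds hs] with t ht
      exact integral_kineticFlow m ρ hτ hβ hL.le ht.le hm hB1

end MMC

/-! ### Uniqueness of the weak solution -/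

namespace MMC

variable {d M : ℕ} (m : Fin M → Fin d → ℕ) {τ : Vec d → Vec d → Vec M → ℝ}
  {β α : Vec d → Vec M → Vec d → Vec M → ℝ} {ρ : Measure (Vec d)}

/-- The limiting jump law has the Feller property. -/
theorem continuous_integral_limitJump (hτ : IsFellerDensity τ) (hβ : IsAcceptance β)
    (hβc : Continuous fun q : Vec d × Vec M × Vec d × Vec M => β q.1 q.2.1 q.2.2.1 q.2.2.2)
    {φ : Vec d × Vec M → ℝ} (hφ : Continuous φ) {B : ℝ} (hB : ∀ p, |φ p| ≤ B) :
    Continuous fun p => ∫ q, φ q ∂(limitJump τ β p) := by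
  refine continuous_iff_continuousAt.2 fun p => ?_
  -- Continuity is joint convergence for a constant family indexed by one point.
  have hl : Tendsto (fun q : Vec d × Vec M => ((), q)) (𝓝 p) ((⊤ : Filter Unit) ×ˢ 𝓝 p) :=
    tendsto_top.prodMk tendsto_id
  have hs : ∀ q : Vec d × Vec M, Tendsto
      (fun r : Unit × (Vec d × Vec M) => r.2.2) (⊤ ×ˢ 𝓝 q) (𝓝 q.2) := fun q =>
    (continuous_snd.tendsto q).comp tendsto_snd
  have hb : ∀ q : Vec d × Vec M × Vec d × Vec M, Tendsto
      (fun r : Unit × (Vec d × Vec M × Vec d × Vec M) => β r.2.1 r.2.2.1 r.2.2.2.1 r.2.2.2.2)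
      (⊤ ×ˢ 𝓝 q) (𝓝 (β q.1 q.2.1 q.2.2.1 q.2.2.2)) := fun q =>
    (hβc.tendsto q).comp tendsto_snd
  have hp : ∀ q : Vec d × Vec M, Tendsto
      (Function.uncurry fun (_ : Unit) => φ) (⊤ ×ˢ 𝓝 q) (𝓝 (φ q)) := fun q =>
    (hφ.tendsto q).comp tendsto_snd
  have h := tendsto_integral_jumpLaw hτ (ι := Unit) (βs := fun _ => β)
    (us := fun _ _ κ => κ) (u := fun _ κ => κ) (.of_forall fun _ => hβ)
    hβ hb (fun _ => measurable_snd) measurable_snd hs (fun _ => hφ.measurable) hφ.measurable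
    (fun _ => hB) hB hp p
  have h' : Tendsto (fun p => ∫ q, φ q ∂(limitJump τ β p)) (𝓝 p)
      (𝓝 (∫ q, φ q ∂(limitJump τ β p))) := by
    simpa only [Function.comp_def] using h.comp hl
  exact h'

/-- Relaxation over a positive ratio of times is a homeomorphism. -/
noncomputable def relaxHomeomorph {θ : ℝ} (hθ : θ ≠ 0) : Vec d × Vec M ≃ₜ Vec d × Vec M where
  toFun := relax m θ
  invFun := relax m θ⁻¹
  left_inv p := by rw [relax_relax, inv_mul_cancel₀ hθ, relax_one]
  right_inv p := by rw [relax_relax, mul_inv_cancel₀ hθ, relax_one]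
  continuous_toFun := continuous_relax m θ
  continuous_invFun := continuous_relax m θ⁻¹

theorem relaxGen_relax {φ : Vec d × Vec M → ℝ} (θ : ℝ) (p : Vec d × Vec M) :
    relaxGen m φ (relax m θ p) = -θ * fderiv ℝ φ (relax m θ p) (0, p.2 - momentIncr m p.1) := by
  have h : ((0, momentIncr m (relax m θ p).1 - (relax m θ p).2) : Vec d × Vec M) =
      (-θ) • (0, p.2 - momentIncr m p.1) := by
    ext i
    · simp
    · simp [relax]; ring
  rw [← smul_eq_mul, ← map_smul, ← h]
  rfl

/-- A flow commutes with its generator: at fixed `x`, `relax m θ` is affine in `κ` and scales the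
direction `Δκ - κ` by `θ`, giving exactly that direction at the image point. -/
theorem relaxGen_comp_relax {φ : Vec d × Vec M → ℝ} (hφ : ContDiff ℝ ∞ φ) (θ : ℝ)
    (p : Vec d × Vec M) :
    relaxGen m (fun q => φ (relax m θ q)) p = relaxGen m φ (relax m θ p) := by
  set v : Vec d × Vec M := (0, momentIncr m p.1 - p.2) with hv
  have hline : HasDerivAt (fun ε : ℝ => p + ε • v) v 0 := by
    simpa using ((hasDerivAt_id (0 : ℝ)).smul_const v).const_add p
  have hline' : HasDerivAt (fun ε : ℝ => relax m θ (p + ε • v)) (θ • v) 0 := by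
    have e : (fun ε : ℝ => relax m θ (p + ε • v)) = fun ε => relax m θ p + ε • (θ • v) := by
      funext ε
      ext i
      · simp [relax, hv]
      · simp [relax, hv]; ring
    rw [e]
    simpa using ((hasDerivAt_id (0 : ℝ)).smul_const (θ • v)).const_add (relax m θ p)
  have hd : Differentiable ℝ fun q => φ (relax m θ q) :=
    (hφ.comp (contDiff_relax m θ)).differentiable (by simp)
  have h1 := ((hd (p + (0 : ℝ) • v)).hasFDerivAt).comp_hasDerivAt (0 : ℝ) hline
  have h2 := ((hφ.differentiable (by simp)) (relax m θ (p + (0 : ℝ) • v))).hasFDerivAt.comp_hasDerivAt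
    (0 : ℝ) hline'
  have h3 := h1.unique h2
  simp only [zero_smul, add_zero] at h3
  have h4 : (0, p.2 - momentIncr m p.1) = -v := by simp [hv]
  rw [relaxGen_relax, h4, map_neg, neg_mul_neg, ← smul_eq_mul, ← map_smul]
  exact h3

/-- The function `φ ∘ relax m (r / t)` is `φ` read at time `t` along the characteristic that starts
at time `r`; it solves the backward transport equation. -/
theorem hasDerivAt_comp_relax_div {φ : Vec d × Vec M → ℝ} (hφ : ContDiff ℝ ∞ φ) {r t : ℝ}
    (hr : 0 < r) (ht : 0 < t) (p : Vec d × Vec M) :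
    HasDerivAt (fun s => φ (relax m (s / t) p)) (-(r⁻¹ * relaxGen m φ (relax m (r / t) p))) r := by
  have h1 := ((hφ.differentiable (by simp)) (relax m (r / t) p)).hasFDerivAt.comp_hasDerivAt r
    ((hasDerivAt_relax m (r / t) p).scomp r ((hasDerivAt_id r).div_const t))
  refine h1.congr_deriv ?_
  rw [relaxGen_relax, map_smul, smul_eq_mul]
  field_simp

/-- Strict differentiability gives convergence jointly in the increment and the base point, as
needed to integrate the quotient against a measure that moves too. -/
theorem tendsto_slope_comp_relax_div {φ : Vec d × Vec M → ℝ} (hφ : ContDiff ℝ ∞ φ) {s t : ℝ}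
    (hs : 0 < s) (ht : 0 < t) (p : Vec d × Vec M) :
    Tendsto (Function.uncurry fun (δ : ℝ) q =>
      δ⁻¹ * (φ (relax m ((s + δ) / t) q) - φ (relax m (s / t) q))) (𝓝[≠] 0 ×ˢ 𝓝 p)
      (𝓝 (-(s⁻¹ * relaxGen m φ (relax m (s / t) p)))) := by
  let G : ℝ × (Vec d × Vec M) → ℝ := fun a => φ (relax m (a.1 / t) a.2)
  have hG : ContDiff ℝ ∞ G := hφ.comp ((contDiff_relax_uncurry m).comp
    ((contDiff_fst.div_const t).prodMk contDiff_snd))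
  have hst := hG.contDiffAt.hasStrictFDerivAt (x := (s, p)) (by simp)
  have hval : fderiv ℝ G (s, p) (1, 0) = -(s⁻¹ * relaxGen m φ (relax m (s / t) p)) := by
    have h1 := hst.hasFDerivAt.comp_hasDerivAt s
      ((hasDerivAt_id s).prodMk (hasDerivAt_const s p))
    exact h1.unique (hasDerivAt_comp_relax_div m hφ hs ht p)
  have h0 : Tendsto (fun r : ℝ × (Vec d × Vec M) => r.1) (𝓝[≠] 0 ×ˢ 𝓝 p) (𝓝 0) :=
    tendsto_fst.mono_right nhdsWithin_le_nhds
  have hk : Tendsto (fun r : ℝ × (Vec d × Vec M) => ((s + r.1, r.2), (s, r.2)))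
      (𝓝[≠] 0 ×ˢ 𝓝 p) (𝓝 ((s, p), (s, p))) := by
    refine Tendsto.prodMk_nhds (Tendsto.prodMk_nhds ?_ tendsto_snd)
      (tendsto_const_nhds.prodMk_nhds tendsto_snd)
    simpa using h0.const_add s
  have hne : ∀ᶠ r : ℝ × (Vec d × Vec M) in 𝓝[≠] 0 ×ˢ 𝓝 p, r.1 ≠ 0 :=
    tendsto_fst.eventually self_mem_nhdsWithin
  rw [← hval, Metric.tendsto_nhds]
  intro ε hε
  filter_upwards [hk.eventually (hst.isLittleO.def (half_pos hε)), hne] with r hr hr0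
  have e1 : ((s + r.1, r.2) : ℝ × (Vec d × Vec M)) - (s, r.2) = r.1 • (1, 0) := by
    ext <;> simp
  rw [e1, map_smul, norm_smul, smul_eq_mul, Real.norm_eq_abs, Real.norm_eq_abs] at hr
  have e2 : ‖((1, 0) : ℝ × (Vec d × Vec M))‖ = 1 := by simp [Prod.norm_def]
  rw [e2, mul_one] at hr
  rw [Real.dist_eq]
  have e3 : Function.uncurry (fun (δ : ℝ) q => δ⁻¹ * (φ (relax m ((s + δ) / t) q) -
      φ (relax m (s / t) q))) r - fderiv ℝ G (s, p) (1, 0) =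
      r.1⁻¹ * (G (s + r.1, r.2) - G (s, r.2) - r.1 * fderiv ℝ G (s, p) (1, 0)) := by
    simp only [Function.uncurry, G]
    field_simp
  rw [e3, abs_mul, abs_inv, inv_mul_lt_iff₀ (abs_pos.2 hr0)]
  have := mul_pos (abs_pos.2 hr0) hε
  linarith

/-- Differentiability against test functions gives vague continuity, and probability measures lose
no mass. -/
theorem IsKineticSolution.tendsto_integral {f : ℝ → Measure (Vec d × Vec M)}
    (hf : IsKineticSolution m τ α ρ f) {s : ℝ} (hs : 0 < s) (φ : (Vec d × Vec M) →ᵇ ℝ) :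
    Tendsto (fun r => ∫ p, φ p ∂(f r)) (𝓝 s) (𝓝 (∫ p, φ p ∂(f s))) := by
  have := hf.isProbabilityMeasure s hs
  refine tendsto_integral_of_testFunction ?_ (fun g hg hc => ?_) φ
  · filter_upwards [lt_mem_nhds hs] with r hr using hf.isProbabilityMeasure r hr
  · exact (hf.evolution g hg hc s hs).continuousAt

theorem IsKineticSolution.hasDerivAt_integral {f : ℝ → Measure (Vec d × Vec M)}
    (hf : IsKineticSolution m τ α ρ f) (hτ : IsFellerDensity τ) {L : ℝ}
    (hβ : IsAcceptance β) (hα : ∀ x κ y κ', α x κ y κ' = L * β x κ y κ')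
    {φ : Vec d × Vec M → ℝ} (hφ : ContDiff ℝ ∞ φ) (hc : HasCompactSupport φ) {s : ℝ}
    (hs : 0 < s) :
    HasDerivAt (fun r => ∫ p, φ p ∂(f r))
      (s⁻¹ * (∫ p, relaxGen m φ p ∂(f s)) +
        L * ((∫ p, ∫ q, φ q ∂(limitJump τ β p) ∂(f s)) - ∫ p, φ p ∂(f s))) s := by
  have := hf.isProbabilityMeasure s hs
  obtain ⟨B, hB1, hB2⟩ := exists_bound_testFunction m hφ hc
  have hm := hφ.continuous.measurable
  have j1 : Integrable (relaxGen m φ) (f s) :=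
    integrable_of_continuous_of_bound _ (continuous_relaxGen m hφ) hB2
  have j2 : Integrable (fun p => ∫ q, φ q ∂(limitJump τ β p)) (f s) :=
    .of_bound (measurable_integral_limitJump hτ hβ hm).aestronglyMeasurable B
      (.of_forall (abs_integral_limitJump_le hτ hβ hB1))
  have j3 : Integrable φ (f s) := integrable_of_continuous_of_bound _ hφ.continuous hB1
  have j4 : Integrable (fun p => (∫ q, φ q ∂(limitJump τ β p)) - φ p) (f s) := j2.sub j3
  refine (hf.evolution φ hφ hc s hs).congr_deriv ?_
  have e : ∀ p, fderiv ℝ φ p (0, momentDrift m p.1 p.2 s)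
      + (∫ x, φ (x, p.2) * kineticKernel τ α x p.1 p.2)
      - φ p * ∫ x, kineticKernel τ α x p.1 p.2 =
      s⁻¹ * relaxGen m φ p + L * ((∫ q, φ q ∂(limitJump τ β p)) - φ p) := fun p => by
    rw [add_sub_assoc, integral_mul_kineticKernel_sub hτ hβ hα hm hB1, fderiv_momentDrift]
  simp only [e]
  rw [integral_add (j1.const_mul _) (j4.const_mul _), integral_const_mul,
    integral_const_mul, integral_sub j2 j3]

/-- Product rule: the transport term from the equation cancels the one from the moving test
function, by commutation of the flow with its generator. Only the bounded jump operator is left. -/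
theorem IsKineticSolution.hasDerivAt_integral_comp_relax {f : ℝ → Measure (Vec d × Vec M)}
    (hf : IsKineticSolution m τ α ρ f) (hτ : IsFellerDensity τ) {L : ℝ}
    (hβ : IsAcceptance β) (hα : ∀ x κ y κ', α x κ y κ' = L * β x κ y κ')
    {φ : Vec d × Vec M → ℝ} (hφ : ContDiff ℝ ∞ φ) (hc : HasCompactSupport φ) {s t : ℝ}
    (hs : 0 < s) (ht : 0 < t) :
    HasDerivAt (fun r => ∫ p, φ (relax m (r / t) p) ∂(f r))
      (L * ((∫ p, ∫ q, φ (relax m (s / t) q) ∂(limitJump τ β p) ∂(f s)) -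
        ∫ p, φ (relax m (s / t) p) ∂(f s))) s := by
  have := hf.isProbabilityMeasure s hs
  obtain ⟨B, hB1, hB2⟩ := exists_bound_testFunction m hφ hc
  have hst : s / t ≠ 0 := (div_pos hs ht).ne'
  have hφs : ContDiff ℝ ∞ fun q => φ (relax m (s / t) q) := hφ.comp (contDiff_relax m _)
  have hcs : HasCompactSupport fun q => φ (relax m (s / t) q) :=
    hc.comp_homeomorph (relaxHomeomorph m hst)
  have h1 := hasDerivAt_iff_tendsto_slope_zero.1 (hf.hasDerivAt_integral m hτ hβ hα hφs hcs hs)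
  have h0 : Tendsto (fun δ : ℝ => s + δ) (𝓝[≠] 0) (𝓝 s) := by
    have : ContinuousAt (fun δ : ℝ => s + δ) 0 := by fun_prop
    simpa using this.tendsto.mono_left nhdsWithin_le_nhds
  have hhalf : ∀ᶠ δ : ℝ in 𝓝[≠] 0, s / 2 < s + δ :=
    h0.eventually (lt_mem_nhds (by linarith))
  have h2 : Tendsto (fun δ : ℝ => ∫ q, δ⁻¹ * (φ (relax m ((s + δ) / t) q) -
      φ (relax m (s / t) q)) ∂(f (s + δ))) (𝓝[≠] 0)
      (𝓝 (∫ q, -(s⁻¹ * relaxGen m φ (relax m (s / t) q)) ∂(f s))) := by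
    -- The bound is the mean value inequality on `r > s / 2`, where `r⁻¹` is below `(s / 2)⁻¹`.
    refine tendsto_integral_of_tendsto_prod_nhds (ν := fun δ => f (s + δ)) (B := B * (s / 2)⁻¹)
      ?_ (fun g => (hf.tendsto_integral m hs g).comp h0) ?_ ?_
      (tendsto_slope_comp_relax_div m hφ hs ht)
    · filter_upwards [hhalf] with δ hδ
      have := hf.isProbabilityMeasure (s + δ) (by linarith)
      infer_instance
    · refine .of_forall fun δ => Continuous.measurable ?_
      exact continuous_const.mul ((hφ.continuous.comp (continuous_relax m _)).sub hφs.continuous)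
    · filter_upwards [hhalf, self_mem_nhdsWithin] with δ hδ hδ0 q
      have hmv := (convex_Ioi (s / 2)).norm_image_sub_le_of_norm_hasDerivWithin_le
        (f := fun r => φ (relax m (r / t) q)) (C := B * (s / 2)⁻¹)
        (fun r (hr : s / 2 < r) => (hasDerivAt_comp_relax_div m hφ (by linarith) ht
          q).hasDerivWithinAt)
        (fun r (hr : s / 2 < r) => by
          have hr0 : 0 < r := by linarith
          rw [norm_neg, norm_mul, norm_inv, Real.norm_of_nonneg hr0.le, mul_comm]
          exact mul_le_mul (hB2 _) (by gcongr) (by positivity) ((abs_nonneg _).trans (hB1 0)))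
        (show s ∈ Set.Ioi (s / 2) by simp; linarith) (show s + δ ∈ Set.Ioi (s / 2) from hδ)
      have hδ1 : 0 < |δ| := abs_pos.2 hδ0
      rw [abs_mul, abs_inv, inv_mul_le_iff₀ hδ1, mul_comm |δ|]
      simpa using hmv
  rw [hasDerivAt_iff_tendsto_slope_zero]
  refine ((h2.add h1).congr' ?_).trans_eq ?_
  · filter_upwards [hhalf] with δ hδ
    have := hf.isProbabilityMeasure (s + δ) (by linarith)
    rw [integral_const_mul, integral_sub
      (integrable_of_continuous_of_bound (φ := fun p => φ (relax m ((s + δ) / t) p)) _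
        (hφ.continuous.comp (continuous_relax m _)) fun p => hB1 _) (integrable_of_continuous_of_bound _ hφs.continuous fun p => hB1 _)]
    simp only [smul_eq_mul]
    ring
  · congr 1
    simp only [relaxGen_comp_relax m hφ]
    rw [integral_neg, integral_const_mul]
    ring

/-- Supplies the initial value of the integrated equation. It depends only on `ρ`, so it drops out
of the difference of two solutions. -/
theorem IsKineticSolution.tendsto_integral_comp_relax {f : ℝ → Measure (Vec d × Vec M)}
    (hf : IsKineticSolution m τ α ρ f) [IsProbabilityMeasure ρ] {φ : Vec d × Vec M → ℝ}
    (hφ : Continuous φ) {B : ℝ} (hB : ∀ p, |φ p| ≤ B) (t : ℝ) :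
    Tendsto (fun r => ∫ p, φ (relax m (r / t) p) ∂(f r)) (𝓝[>] 0)
      (𝓝 (∫ p, φ (relax m 0 p) ∂(initialLaw m ρ))) := by
  refine tendsto_integral_of_tendsto_prod_nhds (B := B)
    (ψ := fun r p => φ (relax m (r / t) p)) ?_ (fun g => ?_) ?_ ?_ fun p => ?_
  · filter_upwards [self_mem_nhdsWithin] with r hr
    have := hf.isProbabilityMeasure r hr
    infer_instance
  · rw [integral_initialLaw m ρ g.continuous.measurable]
    exact hf.initial g
  · exact .of_forall fun r => (hφ.comp (continuous_relax m _)).measurable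
  · exact .of_forall fun r p => hB _
  · have hc : Continuous fun a : ℝ × (Vec d × Vec M) => φ (relax m (a.1 / t) a.2) :=
      hφ.comp ((continuous_relax_uncurry m).comp
        ((continuous_fst.div_const t).prodMk continuous_snd))
    have := hc.tendsto (0, p)
    rw [nhds_prod_eq, zero_div] at this
    exact this.mono_left (prod_mono nhdsWithin_le_nhds le_rfl)

/-- A Picard iteration: the derivative of the difference along characteristics is at most `2 L`
times the previous bound, and each integration from time `0` gains one factor of the exponential
series. -/
theorem abs_integral_sub_integral_le_of_isKineticSolution {f g : ℝ → Measure (Vec d × Vec M)}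
    (hf : IsKineticSolution m τ α ρ f) (hg : IsKineticSolution m τ α ρ g)
    [IsProbabilityMeasure ρ] (hτ : IsFellerDensity τ) {L : ℝ} (hL : 0 < L)
    (hβ : IsAcceptance β)
    (hβc : Continuous fun q : Vec d × Vec M × Vec d × Vec M => β q.1 q.2.1 q.2.2.1 q.2.2.2)
    (hα : ∀ x κ y κ', α x κ y κ' = L * β x κ y κ') (k : ℕ) :
    ∀ t, 0 < t → ∀ (φ : Vec d × Vec M → ℝ) (B : ℝ), Continuous φ → (∀ p, |φ p| ≤ B) →
      |∫ p, φ p ∂(f t) - ∫ p, φ p ∂(g t)| ≤ B * (2 * ((2 * L * t) ^ k / (Nat.factorial k : ℝ))) := by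
  induction k with
  | zero =>
    intro t ht φ B hφ hB
    have := hf.isProbabilityMeasure t ht
    have := hg.isProbabilityMeasure t ht
    have h1 := abs_integral_le_of_bound (μ := f t) hB
    have h2 := abs_integral_le_of_bound (μ := g t) hB
    have := abs_sub (∫ p, φ p ∂(f t)) (∫ p, φ p ∂(g t))
    simp only [pow_zero, Nat.factorial_zero, Nat.cast_one, div_one, mul_one]
    linarith
  | succ k ih =>
    intro t ht φ₀ B₀ hφ₀ hB₀
    have := hf.isProbabilityMeasure t ht
    have := hg.isProbabilityMeasure t ht
    -- Only test functions may be put into the equation, but the jump operator does not preserve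
    -- compact support. Hence the induction ranges over bounded continuous functions, which the jump
    -- operator preserves by the Feller property, and each step reduces to test functions.
    refine abs_integral_sub_integral_le_of_testFunction (fun φ B hφ hc hB => ?_) hφ₀ hB₀
    set b : ℝ → ℝ := fun r => B * (2 * ((2 * L * r) ^ (k + 1) / (Nat.factorial (k + 1) : ℝ)))
      with hbdef
    have hbd : ∀ r, HasDerivAt b
        (L * (2 * (B * (2 * ((2 * L * r) ^ k / (Nat.factorial k : ℝ)))))) r := by
      intro r
      have h := (((((hasDerivAt_id r).const_mul (2 * L)).pow (k + 1)).div_const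
        (Nat.factorial (k + 1) : ℝ)).const_mul 2).const_mul B
      refine h.congr_deriv ?_
      rw [Nat.factorial_succ]
      push_cast
      simp only [id, mul_one]
      field_simp
    have hB0 : 0 ≤ B := (abs_nonneg _).trans (hB 0)
    set H : ℝ → ℝ := fun r => ∫ p, φ (relax m (r / t) p) ∂(f r) -
      ∫ p, φ (relax m (r / t) p) ∂(g r) with hHdef
    have hHd := fun (r : ℝ) (hr : 0 < r) =>
      (hf.hasDerivAt_integral_comp_relax m hτ hβ hα hφ hc hr ht).sub
        (hg.hasDerivAt_integral_comp_relax m hτ hβ hα hφ hc hr ht)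
    have hH0 : Tendsto H (𝓝[>] 0) (𝓝 0) := by
      simpa using (hf.tendsto_integral_comp_relax m hφ.continuous hB t).sub
        (hg.tendsto_integral_comp_relax m hφ.continuous hB t)
    have key : ∀ ε : ℝ, 0 < ε → ε ≤ t → |H t| ≤ |H ε| + b t := by
      -- The equation holds for positive times only, so the inequality is integrated from `ε`, and
      -- `ε` tends to `0` afterwards.
      intro ε hε hεt
      have hmv := image_norm_le_of_norm_deriv_right_le_deriv_boundary (f := H) (a := ε) (b := t)
        (B := fun r => |H ε| + (b r - b ε))
        (fun r hr => (hHd r (hε.trans_le hr.1)).continuousAt.continuousWithinAt)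
        (fun r hr => (hHd r (hε.trans_le hr.1)).hasDerivWithinAt)
        (by simp) (fun r => ((hbd r).sub_const (b ε)).const_add _)
        (fun r hr => by
          have hr0 : 0 < r := hε.trans_le hr.1
          have hψc : Continuous fun p => φ (relax m (r / t) p) :=
            hφ.continuous.comp (continuous_relax m _)
          have q1 := ih r hr0 _ B hψc fun p => hB _
          have q2 := ih r hr0 _ B
            (continuous_integral_limitJump hτ hβ hβc hψc fun p => hB _)
            (abs_integral_limitJump_le hτ hβ fun p => hB _)
          rw [← mul_sub, norm_mul, Real.norm_of_nonneg hL.le, Real.norm_eq_abs]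
          refine mul_le_mul_of_nonneg_left ?_ hL.le
          rw [abs_le] at *
          constructor <;> linarith [q1.1, q1.2, q2.1, q2.2])
        (Set.right_mem_Icc.2 hεt)
      have hbε : 0 ≤ b ε := by positivity
      rw [Real.norm_eq_abs] at hmv
      linarith
    have hHt : H t = ∫ p, φ p ∂(f t) - ∫ p, φ p ∂(g t) := by
      simp only [hHdef, div_self ht.ne', relax_one]
    rw [← hHt]
    refine ge_of_tendsto (x := 𝓝[>] (0 : ℝ)) (f := fun ε => |H ε| + b t) ?_ ?_
    · simpa using hH0.abs.add_const (b t)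
    · filter_upwards [self_mem_nhdsWithin,
        mem_nhdsWithin_of_mem_nhds (Iic_mem_nhds ht)] with ε h1 h2 using key ε h1 h2

theorem IsKineticSolution.unique {f g : ℝ → Measure (Vec d × Vec M)}
    (hf : IsKineticSolution m τ α ρ f) (hg : IsKineticSolution m τ α ρ g)
    [IsProbabilityMeasure ρ] (hτ : IsFellerDensity τ) {L : ℝ} (hL : 0 < L)
    (hβ : IsAcceptance β)
    (hβc : Continuous fun q : Vec d × Vec M × Vec d × Vec M => β q.1 q.2.1 q.2.2.1 q.2.2.2)
    (hα : ∀ x κ y κ', α x κ y κ' = L * β x κ y κ') {t : ℝ} (ht : 0 < t) : f t = g t := by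
  have := hf.isProbabilityMeasure t ht
  have := hg.isProbabilityMeasure t ht
  refine ext_of_forall_integral_eq_of_IsFiniteMeasure fun φ => ?_
  rw [← sub_eq_zero, ← abs_nonpos_iff]
  have hlim := (((FloorSemiring.tendsto_pow_div_factorial_atTop (2 * L * t)).const_mul 2).const_mul
    ‖φ‖)
  simp only [mul_zero] at hlim
  exact ge_of_tendsto' hlim fun k =>
    abs_integral_sub_integral_le_of_isKineticSolution m hf hg hτ hL hβ hβc hα k t ht φ ‖φ‖
      φ.continuous φ.norm_coe_le_norm

end MMC

namespace MMC

/-! ### Sums as integrals of step functions -/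

section RiemannSum

theorem intervalIntegrable_comp_floor_and_integral (a : ℕ → ℝ) (i : ℕ) :
    IntervalIntegrable (fun x : ℝ => a ⌊x⌋₊) volume (i : ℝ) ((i + 1 : ℕ) : ℝ) ∧
      ∫ x in (i : ℝ)..((i + 1 : ℕ) : ℝ), a ⌊x⌋₊ = a i := by
  -- The open interval is used because the floor jumps at the right endpoint.
  have h : ∀ x ∈ Set.uIoo (i : ℝ) ((i + 1 : ℕ) : ℝ), a i = a ⌊x⌋₊ := by
    intro x hx
    rw [Set.uIoo_of_le (by push_cast; linarith)] at hx
    have hx0 : (0 : ℝ) ≤ x := (Nat.cast_nonneg i).trans hx.1.le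
    rw [(Nat.floor_eq_iff hx0).2 ⟨hx.1.le, by have := hx.2; push_cast at this; exact this⟩]
  refine ⟨(intervalIntegrable_const (c := a i)).congr_uIoo h, ?_⟩
  rw [← intervalIntegral.integral_congr_uIoo h]
  simp

/-- Puts sums of varying length on the fixed interval `[0, 1]`, where dominated convergence applies.
-/
theorem sum_range_eq_mul_integral_floor (a : ℕ → ℝ) {k : ℕ} (hk : k ≠ 0) :
    ∑ i ∈ Finset.range k, a i = k * ∫ θ in (0 : ℝ)..1, a ⌊θ * k⌋₊ := by
  have h := intervalIntegral.sum_integral_adjacent_intervals (μ := volume)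
    (f := fun x : ℝ => a ⌊x⌋₊) (a := fun i : ℕ => (i : ℝ)) (n := k)
    fun i _ => (intervalIntegrable_comp_floor_and_integral a i).1
  simp only [(intervalIntegrable_comp_floor_and_integral a _).2] at h
  have hk' : (k : ℝ) ≠ 0 := Nat.cast_ne_zero.2 hk
  rw [h, intervalIntegral.integral_comp_mul_right (fun x : ℝ => a ⌊x⌋₊) hk', smul_eq_mul,
    mul_inv_cancel_left₀ hk']
  simp

end RiemannSum

/-! ### Expansion of the chain in the number of attempted jumps -/

variable {d M : ℕ} (m : Fin M → Fin d → ℕ) (τ : Vec d → Vec d → Vec M → ℝ)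
  (β : Vec d → Vec M → Vec d → Vec M → ℝ) (ρ : Measure (Vec d))

/-- The unnormalised contribution to the law of the chain after `k` steps of the paths with `j`
attempted jumps. -/
noncomputable def chainPart : ℕ → ℕ → Measure (Vec d × Vec M)
  | 0, _ => initialLaw m ρ
  | _ + 1, 0 => 0
  | j + 1, k + 1 => (chainPart (j + 1) k).map (relax m ((k + 1 : ℕ) / ((k + 1 : ℕ) + 1))) +
      (chainPart j k).bind (stepLaw m τ β (k + 1))

variable {τ β}

theorem isProbabilityMeasure_stepLaw (hτ : IsFellerDensity τ) (hβ : IsAcceptance β) (n : ℕ)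
    (p : Vec d × Vec M) : IsProbabilityMeasure (stepLaw m τ β n p) :=
  isProbabilityMeasure_jumpLaw hτ hβ (measurable_momentUpdate m n) p

theorem measurable_stepLaw (hτ : IsFellerDensity τ) (hβ : IsAcceptance β) (n : ℕ) :
    Measurable (stepLaw m τ β n) :=
  measurable_jumpLaw hτ hβ (measurable_momentUpdate m n)

theorem abs_integral_stepLaw_le (hτ : IsFellerDensity τ) (hβ : IsAcceptance β) (n : ℕ)
    {φ : Vec d × Vec M → ℝ} {B : ℝ} (hB : ∀ p, |φ p| ≤ B) (p : Vec d × Vec M) :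
    |∫ q, φ q ∂(stepLaw m τ β n p)| ≤ B := by
  have := isProbabilityMeasure_stepLaw m hτ hβ n p
  exact abs_integral_le_of_bound hB

theorem measurable_integral_stepLaw (hτ : IsFellerDensity τ) (hβ : IsAcceptance β) (n : ℕ)
    {φ : Vec d × Vec M → ℝ} (hφ : Measurable φ) :
    Measurable fun p => ∫ q, φ q ∂(stepLaw m τ β n p) :=
  measurable_integral_of_measurable (measurable_stepLaw m hτ hβ n)
    (isProbabilityMeasure_stepLaw m hτ hβ n) hφ

/-- The recursion for the masses is Pascal's rule: one path for each choice of the `j` attempts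
among `k` steps. -/
theorem chainPart_univ (hτ : IsFellerDensity τ) (hβ : IsAcceptance β) [IsProbabilityMeasure ρ]
    (j k : ℕ) : chainPart m τ β ρ j k Set.univ = (k.choose j : ENNReal) := by
  induction k generalizing j with
  | zero => cases j <;> simp [chainPart]
  | succ k ih =>
    cases j with
    | zero => simp [chainPart]
    | succ j =>
      rw [chainPart, Measure.add_apply, Measure.map_apply (continuous_relax m _).measurable .univ,
        Set.preimage_univ, bind_apply_univ (measurable_stepLaw m hτ hβ _)
          (isProbabilityMeasure_stepLaw m hτ hβ _), ih, ih, Nat.choose_succ_succ, Nat.cast_add,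
        add_comm]

theorem isFiniteMeasure_chainPart (hτ : IsFellerDensity τ) (hβ : IsAcceptance β)
    [IsProbabilityMeasure ρ] (j k : ℕ) : IsFiniteMeasure (chainPart m τ β ρ j k) :=
  ⟨by rw [chainPart_univ m ρ hτ hβ]; exact ENNReal.natCast_lt_top _⟩

theorem abs_integral_chainPart_le (hτ : IsFellerDensity τ) (hβ : IsAcceptance β)
    [IsProbabilityMeasure ρ] (j k : ℕ) {φ : Vec d × Vec M → ℝ} {B : ℝ} (hB : ∀ p, |φ p| ≤ B) :
    |∫ p, φ p ∂(chainPart m τ β ρ j k)| ≤ B * k.choose j := by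
  have := isFiniteMeasure_chainPart m ρ hτ hβ j k
  refine (norm_integral_le_of_norm_le_const (f := φ) (.of_forall hB)).trans ?_
  rw [measureReal_def, chainPart_univ m ρ hτ hβ, ENNReal.toReal_natCast]

theorem integral_chainPart_eq_zero (hτ : IsFellerDensity τ) (hβ : IsAcceptance β)
    [IsProbabilityMeasure ρ] {j k : ℕ} (hjk : k < j) (φ : Vec d × Vec M → ℝ) :
    ∫ p, φ p ∂(chainPart m τ β ρ j k) = 0 := by
  have : chainPart m τ β ρ j k = 0 := by
    rw [← Measure.measure_univ_eq_zero, chainPart_univ m ρ hτ hβ, Nat.choose_eq_zero_of_lt hjk,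
      Nat.cast_zero]
  rw [this, integral_zero_measure]

theorem integral_chainPart_succ_succ (hτ : IsFellerDensity τ) (hβ : IsAcceptance β)
    [IsProbabilityMeasure ρ] (j k : ℕ) {φ : Vec d × Vec M → ℝ} (hφ : Measurable φ) {B : ℝ}
    (hB : ∀ p, |φ p| ≤ B) :
    ∫ p, φ p ∂(chainPart m τ β ρ (j + 1) (k + 1)) =
      (∫ p, φ (relax m ((k + 1 : ℕ) / ((k + 1 : ℕ) + 1)) p) ∂(chainPart m τ β ρ (j + 1) k)) +
        ∫ p, ∫ q, φ q ∂(stepLaw m τ β (k + 1) p) ∂(chainPart m τ β ρ j k) := by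
  have := isFiniteMeasure_chainPart m ρ hτ hβ j k
  have := isFiniteMeasure_chainPart m ρ hτ hβ (j + 1) k
  have := isFiniteMeasure_bind (μ := chainPart m τ β ρ j k) (measurable_stepLaw m hτ hβ (k + 1))
    (isProbabilityMeasure_stepLaw m hτ hβ _)
  have hi : ∀ μ : Measure (Vec d × Vec M), IsFiniteMeasure μ → Integrable φ μ := fun μ _ =>
    .of_bound hφ.aestronglyMeasurable B (.of_forall hB)
  have hr := (continuous_relax m ((k + 1 : ℕ) / ((k + 1 : ℕ) + 1))).measurable
  rw [chainPart, integral_add_measure (hi _ inferInstance) (hi _ inferInstance),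
    integral_map hr.aemeasurable hφ.aestronglyMeasurable,
    integral_bind_of_bound (measurable_stepLaw m hτ hβ _) (isProbabilityMeasure_stepLaw m hτ hβ _)
      hφ hB]

/-- Decomposition by the last attempted jump. If it is made in step `i + 1`, it leads to the state
of index `i + 2`, and the later updates up to index `k + 1` telescope to the ratio `(i + 2) / (k +
1)`. -/
theorem integral_chainPart_succ (hτ : IsFellerDensity τ) (hβ : IsAcceptance β)
    [IsProbabilityMeasure ρ] (j k : ℕ) {φ : Vec d × Vec M → ℝ} (hφ : Measurable φ) {B : ℝ}
    (hB : ∀ p, |φ p| ≤ B) :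
    ∫ p, φ p ∂(chainPart m τ β ρ (j + 1) k) = ∑ i ∈ Finset.range k,
      ∫ p, ∫ q, φ (relax m (((i : ℝ) + 2) / (k + 1)) q) ∂(stepLaw m τ β (i + 1) p)
        ∂(chainPart m τ β ρ j i) := by
  induction k generalizing φ with
  | zero => simp [chainPart]
  | succ k ih =>
    rw [integral_chainPart_succ_succ m ρ hτ hβ j k hφ hB, Finset.sum_range_succ,
      ih (φ := fun p => φ (relax m ((k + 1 : ℕ) / ((k + 1 : ℕ) + 1)) p))
        (hφ.comp (continuous_relax m _).measurable) fun p => hB _]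
    have hk : (k : ℝ) + 1 ≠ 0 := by positivity
    have hk' : (k : ℝ) + 1 + 1 ≠ 0 := by positivity
    congr 1
    · refine Finset.sum_congr rfl fun i _ => ?_
      simp only [relax_relax]
      have e : ((k + 1 : ℕ) : ℝ) / (((k + 1 : ℕ) : ℝ) + 1) * (((i : ℝ) + 2) / (k + 1)) =
          ((i : ℝ) + 2) / (((k + 1 : ℕ) : ℝ) + 1) := by
        push_cast
        field_simp
      rw [e]
    · have e : ((k : ℝ) + 2) / (((k + 1 : ℕ) : ℝ) + 1) = 1 := by
        push_cast
        rw [div_eq_one_iff_eq hk']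
        ring
      simp only [e, relax_one]

variable {a : Vec d → Vec M → Vec d → Vec M → ℝ}

/-- A step with a small acceptance probability is a mixture of a relaxation and an attempted
jump. -/
theorem integral_stepLaw_eq (hτ : IsFellerDensity τ) (hβ : IsAcceptance β) (ha : IsAcceptance a)
    {γ : ℝ} (hγ : ∀ x κ y κ', a x κ y κ' = γ * β x κ y κ') (n : ℕ) {φ : Vec d × Vec M → ℝ}
    (hφ : Measurable φ) {B : ℝ} (hB : ∀ p, |φ p| ≤ B) (p : Vec d × Vec M) :
    ∫ q, φ q ∂(stepLaw m τ a n p) = (1 - γ) * φ (relax m (n / (n + 1)) p) +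
      γ * ∫ q, φ q ∂(stepLaw m τ β n p) := by
  have hu := measurable_momentUpdate (d := d) m n
  have := hτ.isProbabilityMeasure p
  have hb := (hβ.measurable_comp hu).comp (measurable_prodMk_left (x := p))
  have hz : Measurable fun z : Vec d => φ (z, momentUpdate m n z p.2) :=
    hφ.comp (measurable_id.prodMk (hu.comp (by fun_prop : Measurable fun z : Vec d => (z, p.2))))
  rw [stepLaw_eq_jumpLaw, stepLaw_eq_jumpLaw, integral_jumpLaw hτ ha hu hφ hB,
    integral_jumpLaw hτ hβ hu hφ hB, relax_eq_momentUpdate]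
  have hi : Integrable (fun z => β z (momentUpdate m n z p.2) p.1 (momentUpdate m n p.1 p.2) *
      φ (z, momentUpdate m n z p.2) + (1 - β z (momentUpdate m n z p.2) p.1
        (momentUpdate m n p.1 p.2)) * φ (p.1, momentUpdate m n p.1 p.2)) (proposalLaw τ p) :=
    .of_bound ((hb.mul hz).add ((measurable_const.sub hb).mul
      measurable_const)).aestronglyMeasurable B
      (.of_forall fun z => hβ.abs_convexComb_le (hB _) (hB _))
  rw [← integral_const_mul]
  have e : (1 - γ) * φ (p.1, momentUpdate m n p.1 p.2) =
      ∫ _, (1 - γ) * φ (p.1, momentUpdate m n p.1 p.2) ∂(proposalLaw τ p) := by simp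
  rw [e, ← integral_add (integrable_const _) (hi.const_mul γ)]
  refine integral_congr_ae (.of_forall fun z => ?_)
  simp only [hγ]
  ring

theorem isProbabilityMeasure_chainLaw (hτ : IsFellerDensity τ) (ha : IsAcceptance a)
    [IsProbabilityMeasure ρ] (k : ℕ) : IsProbabilityMeasure (chainLaw m τ a ρ (k + 1)) := by
  induction k with
  | zero =>
    rw [chainLaw]
    exact isProbabilityMeasure_initialLaw m ρ
  | succ k ih =>
    refine ⟨?_⟩
    rw [chainLaw, bind_apply_univ (measurable_stepLaw m hτ ha _)
      (isProbabilityMeasure_stepLaw m hτ ha _), measure_univ]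

/-- The law of the chain as a sum over the number of attempted jumps. -/
theorem integral_chainLaw (hτ : IsFellerDensity τ) (hβ : IsAcceptance β) (ha : IsAcceptance a)
    {γ : ℝ} (hγ : ∀ x κ y κ', a x κ y κ' = γ * β x κ y κ') [IsProbabilityMeasure ρ] (k : ℕ)
    {φ : Vec d × Vec M → ℝ} (hφ : Measurable φ) {B : ℝ} (hB : ∀ p, |φ p| ≤ B) :
    ∫ p, φ p ∂(chainLaw m τ a ρ (k + 1)) = ∑ j ∈ Finset.range (k + 1),
      (1 - γ) ^ (k - j) * (γ ^ j * ∫ p, φ p ∂(chainPart m τ β ρ j k)) := by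
  induction k generalizing φ B with
  | zero =>
    simp only [zero_add, Finset.range_one, Finset.sum_singleton, pow_zero, one_mul, Nat.sub_zero]
    rfl
  | succ k ih =>
    have := isProbabilityMeasure_chainLaw m ρ hτ ha k
    set θ : ℝ := (k + 1 : ℕ) / ((k + 1 : ℕ) + 1) with hθ
    set ψ : Vec d × Vec M → ℝ := fun p => (1 - γ) * φ (relax m θ p) +
      γ * ∫ q, φ q ∂(stepLaw m τ β (k + 1) p) with hψ
    have mr : Measurable fun p => φ (relax m θ p) := hφ.comp (continuous_relax m θ).measurable
    have ms := measurable_integral_stepLaw m hτ hβ (k + 1) hφ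
    have bs := abs_integral_stepLaw_le m hτ hβ (k + 1) hB
    have hψm : Measurable ψ := (mr.const_mul _).add (ms.const_mul _)
    -- The expansion is an algebraic identity in `γ`, which is not required to lie in `[0, 1]`;
    -- hence the absolute values.
    have hψB : ∀ p, |ψ p| ≤ |1 - γ| * B + |γ| * B := fun p => by
      refine (abs_add_le _ _).trans ?_
      rw [abs_mul, abs_mul]
      have h1 := hB (relax m θ p)
      have h2 := bs p
      gcongr
    have hψi : ∀ j, ∫ p, ψ p ∂(chainPart m τ β ρ j k) =
        (1 - γ) * (∫ p, φ (relax m θ p) ∂(chainPart m τ β ρ j k)) +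
          γ * ∫ p, ∫ q, φ q ∂(stepLaw m τ β (k + 1) p) ∂(chainPart m τ β ρ j k) := fun j => by
      have := isFiniteMeasure_chainPart m ρ hτ hβ j k
      rw [← integral_const_mul, ← integral_const_mul, ← integral_add]
      · exact (Integrable.of_bound mr.aestronglyMeasurable B
          (.of_forall fun p => hB _)).const_mul _
      · exact (Integrable.of_bound ms.aestronglyMeasurable B (.of_forall bs)).const_mul _
    rw [chainLaw, integral_bind_of_bound (measurable_stepLaw m hτ ha _)
      (isProbabilityMeasure_stepLaw m hτ ha _) hφ hB]
    simp only [integral_stepLaw_eq m hτ hβ ha hγ _ hφ hB]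
    rw [ih hψm hψB]
    have h0 : ∫ p, φ p ∂(chainPart m τ β ρ 0 (k + 1)) =
        ∫ p, φ (relax m θ p) ∂(chainPart m τ β ρ 0 k) := by
      simp only [chainPart]
      rw [integral_initialLaw m ρ hφ, integral_initialLaw m ρ mr]
      simp only [relax_momentIncr]
    -- There cannot be `k + 1` attempts in `k` steps. This null term lets the sum be shifted by one
    -- without changing its range.
    have hlast : ∫ p, φ (relax m θ p) ∂(chainPart m τ β ρ (k + 1) k) = 0 :=
      integral_chainPart_eq_zero m ρ hτ hβ (Nat.lt_succ_self k) _
    have hshift : ∑ j ∈ Finset.range (k + 1), (1 - γ) ^ (k + 1 - j) * (γ ^ j *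
        ∫ p, φ (relax m θ p) ∂(chainPart m τ β ρ j k)) =
        (∑ j ∈ Finset.range (k + 1), (1 - γ) ^ (k - j) * (γ ^ (j + 1) *
          ∫ p, φ (relax m θ p) ∂(chainPart m τ β ρ (j + 1) k))) +
        (1 - γ) ^ (k + 1) * ∫ p, φ (relax m θ p) ∂(chainPart m τ β ρ 0 k) := by
      rw [Finset.sum_range_succ', Finset.sum_range_succ _ k, hlast]
      simp
    have e1 : ∀ j ∈ Finset.range (k + 1), (1 - γ) ^ (k - j) *
        (γ ^ j * ∫ p, ψ p ∂(chainPart m τ β ρ j k)) =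
        (1 - γ) ^ (k + 1 - j) * (γ ^ j * ∫ p, φ (relax m θ p) ∂(chainPart m τ β ρ j k)) +
        (1 - γ) ^ (k - j) * (γ ^ (j + 1) *
          ∫ p, ∫ q, φ q ∂(stepLaw m τ β (k + 1) p) ∂(chainPart m τ β ρ j k)) := by
      intro j hj
      rw [hψi, Nat.succ_sub (Nat.lt_succ_iff.1 (Finset.mem_range.1 hj)), pow_succ _ (k - j)]
      ring
    have e2 : ∀ j ∈ Finset.range (k + 1), (1 - γ) ^ (k + 1 - (j + 1)) *
        (γ ^ (j + 1) * ∫ p, φ p ∂(chainPart m τ β ρ (j + 1) (k + 1))) =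
        (1 - γ) ^ (k - j) * (γ ^ (j + 1) *
          ∫ p, φ (relax m θ p) ∂(chainPart m τ β ρ (j + 1) k)) +
        (1 - γ) ^ (k - j) * (γ ^ (j + 1) *
          ∫ p, ∫ q, φ q ∂(stepLaw m τ β (k + 1) p) ∂(chainPart m τ β ρ j k)) := by
      intro j _
      rw [integral_chainPart_succ_succ m ρ hτ hβ j k hφ hB, Nat.add_sub_add_right]
      ring
    rw [Finset.sum_range_succ' _ (k + 1), Finset.sum_congr rfl e1, Finset.sum_congr rfl e2,
      Finset.sum_add_distrib,
      Finset.sum_add_distrib, hshift, h0]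
    simp only [pow_zero, one_mul, Nat.sub_zero]
    ring

end MMC

namespace MMC

/-! ### Exponential limits and joint convergence -/

section Limits

/-- After taking logarithms, `e * log (1 - γ)` is squeezed between `-e γ / (1 - γ)` and `-e γ`. The
exponent `e` need not tend to infinity. -/
theorem tendsto_one_sub_pow_exp {ι : Type*} {l : Filter ι} {γ : ι → ℝ} {e : ι → ℕ} {x : ℝ}
    (hγ : Tendsto γ l (𝓝 0)) (he : Tendsto (fun i => e i * γ i) l (𝓝 x)) :
    Tendsto (fun i => (1 - γ i) ^ e i) l (𝓝 (Real.exp (-x))) := by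
  have hlt : ∀ᶠ i in l, γ i < 1 := hγ.eventually (gt_mem_nhds one_pos)
  have h1 : Tendsto (fun i => e i * Real.log (1 - γ i)) l (𝓝 (-x)) := by
    refine tendsto_of_tendsto_of_tendsto_of_le_of_le'
      (g := fun i => -(e i * γ i) * (1 - γ i)⁻¹) (h := fun i => -(e i * γ i)) ?_ he.neg ?_ ?_
    · have := he.neg.mul ((hγ.const_sub 1).inv₀ (by simp))
      simpa using this
    · filter_upwards [hlt] with i hi
      have hpos : 0 < 1 - γ i := by linarith
      have h := Real.one_sub_inv_le_log_of_pos hpos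
      have e1 : 1 - (1 - γ i)⁻¹ = -γ i * (1 - γ i)⁻¹ := by
        field_simp
        ring
      rw [e1] at h
      calc -(e i * γ i) * (1 - γ i)⁻¹ = e i * (-γ i * (1 - γ i)⁻¹) := by ring
        _ ≤ _ := by gcongr
    · filter_upwards [hlt] with i hi
      have h := Real.log_le_sub_one_of_pos (by linarith : 0 < 1 - γ i)
      calc e i * Real.log (1 - γ i) ≤ e i * (1 - γ i - 1) := by gcongr
        _ = _ := by ring
  refine ((Real.continuous_exp.tendsto _).comp h1).congr' ?_
  filter_upwards [hlt] with i hi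
  rw [Function.comp_apply, ← Real.log_pow, Real.exp_log (pow_pos (by linarith) _)]

theorem tendsto_prod_of_tendstoLocallyUniformly {X : Type*} [TopologicalSpace X] {ι : Type*}
    {l : Filter ι} {F : ι → X → ℝ} {f : X → ℝ} (h : TendstoLocallyUniformly F f l)
    (hf : Continuous f) (x : X) :
    Tendsto (fun r : ι × X => F r.1 r.2) (l ×ˢ 𝓝 x) (𝓝 (f x)) :=
  ((hf.tendsto x).comp tendsto_snd).congr_dist
    (tendsto_uniformity_iff_dist_tendsto_zero.1 (tendstoLocallyUniformly_iff_forall_tendsto.1 h x))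

end Limits

/-! ### Convergence of the chain -/

variable {d M : ℕ} (m : Fin M → Fin d → ℕ) {τ : Vec d → Vec d → Vec M → ℝ}
  {β : Vec d → Vec M → Vec d → Vec M → ℝ} (ρ : Measure (Vec d))

/-- A single update is relaxation by `n / (n + 1) → 1`; this is why the moments do not change at a
jump of the limit process. -/
theorem tendsto_momentUpdate {ι : Type*} {l : Filter ι} {n : ι → ℕ} (hn : Tendsto n l atTop)
    (p : Vec d × Vec M) :
    Tendsto (fun r : ι × (Vec d × Vec M) => momentUpdate m (n r.1) r.2.1 r.2.2) (l ×ˢ 𝓝 p)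
      (𝓝 p.2) := by
  have h1 : Tendsto (fun r : ι × (Vec d × Vec M) => ((n r.1 : ℝ) / (n r.1 + 1), r.2))
      (l ×ˢ 𝓝 p) (𝓝 (1, p)) :=
    (((tendsto_natCast_div_add_atTop (1 : ℝ)).comp hn).comp tendsto_fst).prodMk_nhds tendsto_snd
  have h2 := (continuous_snd.comp (continuous_relax_uncurry m)).continuousAt.tendsto.comp h1
  simpa only [Function.comp_def, relax_eq_momentUpdate, relax_one] using h2

/-- The mass is at most `i ^ j ≤ k ^ j`; this is the majorant for the Riemann sums. -/
theorem abs_inv_pow_mul_integral_chainPart_le (hτ : IsFellerDensity τ) (hβ : IsAcceptance β)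
    [IsProbabilityMeasure ρ] {j i k : ℕ} (hik : i ≤ k) {φ : Vec d × Vec M → ℝ} {B : ℝ}
    (hB : ∀ p, |φ p| ≤ B) : |((k : ℝ) ^ j)⁻¹ * ∫ p, φ p ∂(chainPart m τ β ρ j i)| ≤ B := by
  have hB0 : 0 ≤ B := (abs_nonneg _).trans (hB 0)
  have h1 := abs_integral_chainPart_le m ρ hτ hβ j i hB
  have h2 : (i.choose j : ℝ) ≤ (k : ℝ) ^ j := by
    calc (i.choose j : ℝ) ≤ ((i ^ j : ℕ) : ℝ) := by exact_mod_cast Nat.choose_le_pow i j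
      _ ≤ _ := by push_cast; gcongr
  have hk : 0 ≤ (k : ℝ) ^ j := by positivity
  rw [abs_mul, abs_inv, abs_of_nonneg hk]
  calc ((k : ℝ) ^ j)⁻¹ * |∫ p, φ p ∂(chainPart m τ β ρ j i)|
      ≤ ((k : ℝ) ^ j)⁻¹ * (B * (k : ℝ) ^ j) := by gcongr; exact h1.trans (by gcongr)
    _ = B * (((k : ℝ) ^ j)⁻¹ * (k : ℝ) ^ j) := by ring
    _ ≤ B * 1 := by gcongr; exact inv_mul_le_one
    _ = B := mul_one B

/-- Joint convergence of one step of the chain, after relaxation of the moments. -/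
theorem tendsto_integral_stepLaw_relax (hτ : IsFellerDensity τ) (hβ : IsAcceptance β)
    {ι : Type*} {l : Filter ι} {βs : ι → Vec d → Vec M → Vec d → Vec M → ℝ}
    (hβs : ∀ᶠ i in l, IsAcceptance (βs i))
    (hβl : ∀ q : Vec d × Vec M × Vec d × Vec M, Tendsto
      (fun r : ι × (Vec d × Vec M × Vec d × Vec M) => βs r.1 r.2.1 r.2.2.1 r.2.2.2.1 r.2.2.2.2)
      (l ×ˢ 𝓝 q) (𝓝 (β q.1 q.2.1 q.2.2.1 q.2.2.2)))
    {n : ι → ℕ} (hn : Tendsto n l atTop) {θs : ι → ℝ} {θ : ℝ} (hθ : Tendsto θs l (𝓝 θ))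
    (φ : (Vec d × Vec M) →ᵇ ℝ) (p : Vec d × Vec M) :
    Tendsto (fun r : ι × (Vec d × Vec M) =>
        ∫ q, φ (relax m (θs r.1) q) ∂(stepLaw m τ (βs r.1) (n r.1) r.2))
      (l ×ˢ 𝓝 p) (𝓝 (∫ q, φ (relax m θ q) ∂(limitJump τ β p))) := by
  have hm := φ.continuous.measurable
  have hms : ∀ θ, Measurable fun q : Vec d × Vec M => φ (relax m θ q) := fun θ =>
    hm.comp (continuous_relax m θ).measurable
  have hφl : ∀ q : Vec d × Vec M, Tendsto
      (Function.uncurry fun (i : ι) (q : Vec d × Vec M) => φ (relax m (θs i) q)) (l ×ˢ 𝓝 q)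
      (𝓝 (φ (relax m θ q))) := fun q => by
    have h1 : Tendsto (fun r : ι × (Vec d × Vec M) => (θs r.1, r.2)) (l ×ˢ 𝓝 q) (𝓝 (θ, q)) :=
      (hθ.comp tendsto_fst).prodMk_nhds tendsto_snd
    have h2 : Continuous fun q : ℝ × (Vec d × Vec M) => φ (relax m q.1 q.2) :=
      φ.continuous.comp (continuous_relax_uncurry m)
    exact (h2.tendsto (θ, q)).comp h1
  have h := tendsto_integral_jumpLaw hτ hβs hβ hβl (u := fun _ κ => κ)
    (fun i => measurable_momentUpdate m (n i)) measurable_snd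
    (fun q => tendsto_momentUpdate m hn q) (fun i => hms (θs i)) (hms θ)
    (fun i q => φ.norm_coe_le_norm _) (fun q => φ.norm_coe_le_norm _) hφl p
  simp only [stepLaw_eq_jumpLaw]
  exact h

/-- Convergence of the rescaled contribution of the paths with `j` attempted jumps. -/
theorem tendsto_integral_chainPart (hτ : IsFellerDensity τ) (hβ : IsAcceptance β)
    {βs : ℕ → Vec d → Vec M → Vec d → Vec M → ℝ} (hβs : ∀ N, 1 ≤ N → IsAcceptance (βs N))
    (hβl : ∀ q : Vec d × Vec M × Vec d × Vec M, Tendsto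
      (fun r : ℕ × (Vec d × Vec M × Vec d × Vec M) => βs r.1 r.2.1 r.2.2.1 r.2.2.2.1 r.2.2.2.2)
      (atTop ×ˢ 𝓝 q) (𝓝 (β q.1 q.2.1 q.2.2.1 q.2.2.2)))
    [IsProbabilityMeasure ρ] (j : ℕ) (φ : (Vec d × Vec M) →ᵇ ℝ) :
    Tendsto (fun r : ℕ × ℕ => ((r.2 : ℝ) ^ j)⁻¹ * ∫ p, φ p ∂(chainPart m τ (βs r.1) ρ j r.2))
      (atTop ×ˢ atTop) (𝓝 (∫ p, φ p ∂(jumpPart m τ β ρ j))) := by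
  induction j generalizing φ with
  | zero => simp [chainPart, jumpPart]
  | succ j ih =>
    have hB : ∀ p, |φ p| ≤ ‖φ‖ := φ.norm_coe_le_norm
    have hm := φ.continuous.measurable
    have hN : ∀ᶠ r : ℕ × ℕ in atTop ×ˢ atTop, 1 ≤ r.1 :=
      tendsto_fst.eventually (eventually_ge_atTop 1)
    have hk : ∀ᶠ r : ℕ × ℕ in atTop ×ˢ atTop, 1 ≤ r.2 :=
      tendsto_snd.eventually (eventually_ge_atTop 1)
    set ψ : ℕ × ℕ → ℕ → Vec d × Vec M → ℝ := fun r i p =>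
      ∫ q, φ (relax m (((i : ℝ) + 2) / (r.2 + 1)) q) ∂(stepLaw m τ (βs r.1) (i + 1) p) with hψ
    have hψB : ∀ r : ℕ × ℕ, 1 ≤ r.1 → ∀ i p, |ψ r i p| ≤ ‖φ‖ := fun r hr i p =>
      abs_integral_stepLaw_le m hτ (hβs _ hr) _ (fun q => hB _) p
    set G : ℕ × ℕ → ℕ → ℝ := fun r i =>
      ((r.2 : ℝ) ^ j)⁻¹ * ∫ p, ψ r i p ∂(chainPart m τ (βs r.1) ρ j i) with hG
    have heq : ∀ᶠ r : ℕ × ℕ in atTop ×ˢ atTop, ∫ θ in (0 : ℝ)..1, G r ⌊θ * r.2⌋₊ =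
        ((r.2 : ℝ) ^ (j + 1))⁻¹ * ∫ p, φ p ∂(chainPart m τ (βs r.1) ρ (j + 1) r.2) := by
      filter_upwards [hN, hk] with r hr1 hr2
      have hr : r.2 ≠ 0 := by omega
      have hr' : (r.2 : ℝ) ≠ 0 := Nat.cast_ne_zero.2 hr
      have h := sum_range_eq_mul_integral_floor (G r) hr
      rw [integral_chainPart_succ m ρ hτ (hβs _ hr1) j r.2 hm hB]
      have h' : ∑ i ∈ Finset.range r.2, G r i = ((r.2 : ℝ) ^ j)⁻¹ *
          ∑ i ∈ Finset.range r.2, ∫ p, ψ r i p ∂(chainPart m τ (βs r.1) ρ j i) := by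
        rw [Finset.mul_sum]
      rw [h'] at h
      rw [pow_succ, mul_inv, mul_right_comm, h]
      generalize ∫ θ in (0 : ℝ)..1, G r ⌊θ * r.2⌋₊ = I
      field_simp
    rw [integral_jumpPart_succ' m ρ hτ hβ j hm hB]
    refine Tendsto.congr' heq ?_
    refine intervalIntegral.tendsto_integral_filter_of_dominated_convergence (fun _ => ‖φ‖)
      ?_ ?_ intervalIntegrable_const ?_
    · refine .of_forall fun r => Measurable.aestronglyMeasurable ?_
      exact (measurable_from_nat (f := G r)).comp
        (Nat.measurable_floor.comp (measurable_id.mul_const _))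
    · filter_upwards [hN] with r hr1
      refine .of_forall fun θ hθ => ?_
      rw [Set.uIoc_of_le zero_le_one] at hθ
      have hle : ⌊θ * r.2⌋₊ ≤ r.2 := by
        refine Nat.floor_le_of_le ?_
        calc θ * r.2 ≤ 1 * r.2 := by gcongr; exact hθ.2
          _ = r.2 := one_mul _
      exact abs_inv_pow_mul_integral_chainPart_le m ρ hτ (hβs _ hr1) hle (hψB r hr1 _)
    · refine .of_forall fun θ hθ => ?_
      rw [Set.uIoc_of_le zero_le_one] at hθ
      have hi : Tendsto (fun k : ℕ => ⌊θ * k⌋₊) atTop atTop := tendsto_nat_floor_mul_atTop θ hθ.1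
      have hi2 : Tendsto (fun r : ℕ × ℕ => ⌊θ * r.2⌋₊) (atTop ×ˢ atTop) atTop :=
        hi.comp tendsto_snd
      have hi3 : Tendsto (fun r : ℕ × ℕ => ⌊θ * r.2⌋₊ + 1) (atTop ×ˢ atTop) atTop :=
        (tendsto_add_atTop_nat 1).comp hi2
      have hr : Tendsto (fun r : ℕ × ℕ => (r.1, ⌊θ * r.2⌋₊)) (atTop ×ˢ atTop)
          (atTop ×ˢ atTop) := tendsto_fst.prodMk hi2
      have hratio : Tendsto (fun k : ℕ => (⌊θ * k⌋₊ : ℝ) / k) atTop (𝓝 θ) :=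
        (tendsto_nat_floor_mul_div_atTop hθ.1.le).comp tendsto_natCast_atTop_atTop
      have hratio' : Tendsto (fun k : ℕ => ((⌊θ * k⌋₊ : ℝ) + 2) / (k + 1)) atTop (𝓝 θ) := by
        have h1 : Tendsto (fun k : ℕ => 2 / (k : ℝ)) atTop (𝓝 0) :=
          tendsto_const_div_atTop_nhds_zero_nat 2
        have h2 := (hratio.add h1).mul (tendsto_natCast_div_add_atTop (1 : ℝ))
        rw [add_zero, mul_one] at h2
        refine h2.congr' ?_
        filter_upwards [eventually_ge_atTop 1] with k hk
        have : (k : ℝ) ≠ 0 := Nat.cast_ne_zero.2 (by omega)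
        field_simp
      have hfin := isFiniteMeasure_jumpPart m ρ hτ hβ j
      -- With `i = ⌊θ * k⌋₊`, the induction hypothesis applies to the normalisation by `i ^ j`,
      -- whereas `G` carries `k ^ j`. The quotient `(i / k) ^ j` tends to `θ ^ j`, the weight in the
      -- definition of `jumpPart`.
      have hlim : Tendsto (fun r : ℕ × ℕ => ∫ p, ψ r ⌊θ * r.2⌋₊ p
          ∂(ENNReal.ofReal ((⌊θ * r.2⌋₊ : ℝ) ^ j)⁻¹ • chainPart m τ (βs r.1) ρ j ⌊θ * r.2⌋₊))
          (atTop ×ˢ atTop)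
          (𝓝 (∫ p, ∫ q, φ (relax m θ q) ∂(limitJump τ β p) ∂(jumpPart m τ β ρ j))) := by
        refine tendsto_integral_of_tendsto_prod_nhds (B := ‖φ‖)
          (ψ := fun r => ψ r ⌊θ * r.2⌋₊) ?_ (fun g => ?_) ?_ ?_ fun p => ?_
        · filter_upwards [hN] with r hr1
          have := isFiniteMeasure_chainPart m ρ hτ (hβs _ hr1) j ⌊θ * r.2⌋₊
          exact Measure.smul_finite _ ENNReal.ofReal_ne_top
        · refine ((ih g).comp hr).congr fun r => ?_
          rw [integral_smul_measure, ENNReal.toReal_ofReal (by positivity), smul_eq_mul]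
          rfl
        · filter_upwards [hN] with r hr1
          exact measurable_integral_stepLaw m hτ (hβs _ hr1) _
            (hm.comp (continuous_relax m _).measurable)
        · filter_upwards [hN] with r hr1
          exact hψB r hr1 _
        · exact tendsto_integral_stepLaw_relax m hτ hβ (hN.mono fun r hr1 => hβs _ hr1)
            (fun q => (hβl q).comp ((tendsto_fst.comp tendsto_fst).prodMk tendsto_snd))
            hi3 (hratio'.comp tendsto_snd) φ p
      refine (((hratio.comp tendsto_snd).pow j).mul hlim).congr' ?_
      filter_upwards [hi2.eventually_ne_atTop 0] with r hr0
      have hr0' : (⌊θ * r.2⌋₊ : ℝ) ≠ 0 := Nat.cast_ne_zero.2 hr0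
      rw [integral_smul_measure, ENNReal.toReal_ofReal (by positivity), smul_eq_mul, ← mul_assoc,
        Function.comp_apply, div_pow]
      simp only [hG]
      congr 1
      field_simp

/-- Convergence of the chain along a sequence of times. -/
theorem tendsto_integral_chainLaw (hτ : IsFellerDensity τ) (hβ : IsAcceptance β)
    {βs : ℕ → Vec d → Vec M → Vec d → Vec M → ℝ} (hβs : ∀ N, 1 ≤ N → IsAcceptance (βs N))
    (hβl : ∀ q : Vec d × Vec M × Vec d × Vec M, Tendsto
      (fun r : ℕ × (Vec d × Vec M × Vec d × Vec M) => βs r.1 r.2.1 r.2.2.1 r.2.2.2.1 r.2.2.2.2)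
      (atTop ×ˢ 𝓝 q) (𝓝 (β q.1 q.2.1 q.2.2.1 q.2.2.2)))
    {as : ℕ → Vec d → Vec M → Vec d → Vec M → ℝ} (has : ∀ N, 1 ≤ N → IsAcceptance (as N))
    {γ : ℕ → ℝ} (hγ0 : ∀ N, 0 ≤ γ N)
    (hγ : ∀ N, 1 ≤ N → ∀ x κ y κ', as N x κ y κ' = γ N * βs N x κ y κ')
    [IsProbabilityMeasure ρ] {l : Filter ℕ} (hl : l ≤ atTop) (hγl : Tendsto γ l (𝓝 0)) {k : ℕ → ℕ}
    {x : ℝ} (hk : Tendsto (fun N => k N * γ N) l (𝓝 x)) (φ : (Vec d × Vec M) →ᵇ ℝ) :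
    Tendsto (fun N => ∫ p, φ p ∂(chainLaw m τ (as N) ρ (k N + 1))) l
      (𝓝 (∑' j, Real.exp (-x) * (x ^ j * ∫ p, φ p ∂(jumpPart m τ β ρ j)))) := by
  have hB : ∀ p, |φ p| ≤ ‖φ‖ := φ.norm_coe_le_norm
  have hm := φ.continuous.measurable
  have hN : ∀ᶠ N in l, 1 ≤ N := hl (eventually_ge_atTop 1)
  have hid : Tendsto (fun N : ℕ => N) l atTop := hl
  have heq : ∀ᶠ N in l, ∑' j, (1 - γ N) ^ (k N - j) * (γ N ^ j *
      ∫ p, φ p ∂(chainPart m τ (βs N) ρ j (k N))) =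
      ∫ p, φ p ∂(chainLaw m τ (as N) ρ (k N + 1)) := by
    filter_upwards [hN] with N hN1
    rw [integral_chainLaw m ρ hτ (hβs N hN1) (has N hN1) (hγ N hN1) (k N) hm hB]
    -- Levels above the number of steps carry no mass, so the finite expansion is a series over all
    -- `j`, ready for dominated convergence.
    refine tsum_eq_sum fun j hj => ?_
    rw [integral_chainPart_eq_zero m ρ hτ (hβs N hN1) (by simpa using hj), mul_zero, mul_zero]
  have hbound : ∀ N, 1 ≤ N → ∀ j, |γ N ^ j * ∫ p, φ p ∂(chainPart m τ (βs N) ρ j (k N))| ≤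
      ‖φ‖ * ((k N * γ N) ^ j / (Nat.factorial j : ℝ)) := by
    intro N hN1 j
    have h1 := abs_integral_chainPart_le m ρ hτ (hβs N hN1) j (k N) hB
    have h2 : ((k N).choose j : ℝ) ≤ (k N : ℝ) ^ j / (Nat.factorial j : ℝ) :=
      Nat.choose_le_pow_div j (k N)
    have h3 := pow_nonneg (hγ0 N) j
    rw [abs_mul, abs_of_nonneg h3]
    calc γ N ^ j * |∫ p, φ p ∂(chainPart m τ (βs N) ρ j (k N))|
        ≤ γ N ^ j * (‖φ‖ * ((k N : ℝ) ^ j / (Nat.factorial j : ℝ))) := by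
          gcongr; exact h1.trans (by gcongr)
      _ = _ := by rw [mul_pow]; ring
  refine Tendsto.congr' heq ?_
  refine tendsto_tsum_of_dominated_convergence
    (bound := fun j => ‖φ‖ * ((x + 1) ^ j / (Nat.factorial j : ℝ)))
    ((Real.summable_pow_div_factorial (x + 1)).mul_left _) (fun j => ?_) ?_
  · refine Tendsto.mul (tendsto_one_sub_pow_exp hγl ?_) ?_
    · have hj : Tendsto (fun N => k N * γ N - j * γ N) l (𝓝 x) := by
        simpa using hk.sub (hγl.const_mul (j : ℝ))
      -- The truncated exponent `k N - j` differs from `k N` by at most `j`, and `j * γ N` tends to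
      -- `0`.
      refine tendsto_of_tendsto_of_tendsto_of_le_of_le hj hk (fun N => ?_) fun N => ?_
      · have : (k N : ℝ) ≤ ((k N - j : ℕ) : ℝ) + j := by
          have : k N ≤ k N - j + j := by omega
          exact_mod_cast this
        nlinarith [mul_le_mul_of_nonneg_right this (hγ0 N)]
      · have : ((k N - j : ℕ) : ℝ) ≤ k N := by exact_mod_cast Nat.sub_le _ _
        exact mul_le_mul_of_nonneg_right this (hγ0 N)
    · rcases Nat.eq_zero_or_pos j with rfl | hj
      · simp only [pow_zero, one_mul, chainPart, jumpPart]
        exact tendsto_const_nhds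
      -- When `x = 0` the number of steps may stay bounded, so the limit of `chainPart` is
      -- unavailable; the factor `(k γ) ^ j` alone kills the term. Otherwise `γ → 0` forces `k → ∞`.
      by_cases hx : x = 0
      · rw [hx, zero_pow hj.ne', zero_mul]
        have h0 : Tendsto (fun N => ‖φ‖ * ((k N * γ N) ^ j / (Nat.factorial j : ℝ))) l (𝓝 0) := by
          have := ((hk.pow j).div_const (Nat.factorial j : ℝ)).const_mul ‖φ‖
          simpa [hx, zero_pow hj.ne'] using this
        refine squeeze_zero_norm' ?_ h0
        filter_upwards [hN] with N hN1 using hbound N hN1 j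
      · have hkt : Tendsto k l atTop := by
          refine tendsto_atTop.2 fun b => ?_
          have h0 : Tendsto (fun N => |k N * γ N| - b * γ N) l (𝓝 |x|) := by
            simpa using hk.abs.sub (hγl.const_mul (b : ℝ))
          filter_upwards [h0.eventually (lt_mem_nhds (abs_pos.2 hx))] with N hN2
          by_contra hlt
          push Not at hlt
          rw [abs_of_nonneg (mul_nonneg (Nat.cast_nonneg _) (hγ0 N))] at hN2
          have : (k N : ℝ) ≤ b := by exact_mod_cast hlt.le
          linarith [mul_le_mul_of_nonneg_right this (hγ0 N)]
        have h1 := (tendsto_integral_chainPart m ρ hτ hβ hβs hβl j φ).comp (hid.prodMk hkt)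
        refine ((hk.pow j).mul h1).congr' ?_
        filter_upwards [hkt.eventually_ne_atTop 0] with N hN0
        have : (k N : ℝ) ≠ 0 := Nat.cast_ne_zero.2 hN0
        rw [Function.comp_apply, ← mul_assoc, mul_pow]
        congr 1
        field_simp
  · filter_upwards [hN, hγl.eventually (gt_mem_nhds one_pos),
      hk.eventually (gt_mem_nhds (lt_add_one x))] with N hN1 hγ1 hk1 j
    have h1 : |(1 - γ N) ^ (k N - j)| ≤ 1 := by
      rw [abs_pow, abs_of_pos (by linarith)]
      exact pow_le_one₀ (by linarith) (by linarith [hγ0 N])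
    have h2 := mul_nonneg (Nat.cast_nonneg (k N)) (hγ0 N)
    rw [norm_mul, Real.norm_eq_abs, Real.norm_eq_abs]
    calc _ ≤ 1 * (‖φ‖ * ((k N * γ N) ^ j / (Nat.factorial j : ℝ))) :=
          mul_le_mul h1 (hbound N hN1 j) (abs_nonneg _) zero_le_one
      _ ≤ _ := by rw [one_mul]; gcongr

theorem stepSize_nonneg (c : ℝ) (N : ℕ) : 0 ≤ stepSize c N := Real.rpow_nonneg (Nat.cast_nonneg N) _

theorem stepSize_pos (c : ℝ) {N : ℕ} (hN : 1 ≤ N) : 0 < stepSize c N :=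
  Real.rpow_pos_of_pos (by exact_mod_cast hN) _

theorem tendsto_stepSize {c : ℝ} (hc : c < 1) : Tendsto (stepSize c) atTop (𝓝 0) := by
  have h := (tendsto_rpow_neg_atTop (sub_pos.2 hc)).comp (tendsto_natCast_atTop_atTop (R := ℝ))
  refine h.congr fun N => ?_
  rw [Function.comp_apply, neg_sub, stepSize]

end MMC

/-! ### The main theorem -/

theorem proposition3p1 {d M : ℕ} (m : Fin M → Fin d → ℕ) (c : ℝ) (hc0 : 0 < c) (hc1 : c < 1)
    -- the law of the first state
    (ρ : Measure (MMC.Vec d)) (hρ : IsProbabilityMeasure ρ)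
    -- the proposal density `τ(z | y, κ)`, weakly continuous in `(y, κ)`
    (τ : MMC.Vec d → MMC.Vec d → MMC.Vec M → ℝ)
    (hτ_meas : Measurable fun q : MMC.Vec d × MMC.Vec d × MMC.Vec M => τ q.1 q.2.1 q.2.2)
    (hτ_nonneg : ∀ z y κ, 0 ≤ τ z y κ)
    (hτ_one : ∀ y κ, ∫ z, τ z y κ = 1)
    (hτ_cont : ∀ g : MMC.Vec d →ᵇ ℝ,
      Continuous fun p : MMC.Vec d × MMC.Vec M => ∫ z, g z * τ z p.1 p.2)
    -- the acceptance rate `αN N` of the chain with `N` iterations, uniformly of order `h`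
    (αN : ℕ → MMC.Vec d → MMC.Vec M → MMC.Vec d → MMC.Vec M → ℝ)
    (hα_meas : ∀ N, 1 ≤ N →
      Measurable fun q : MMC.Vec d × MMC.Vec M × MMC.Vec d × MMC.Vec M =>
        αN N q.1 q.2.1 q.2.2.1 q.2.2.2)
    (hα_mem : ∀ N, 1 ≤ N → ∀ x κ y κ', 0 ≤ αN N x κ y κ' ∧ αN N x κ y κ' ≤ 1)
    (C : ℝ) (hα_order : ∀ N, 1 ≤ N → ∀ x κ y κ', αN N x κ y κ' ≤ C * MMC.stepSize c N)
    -- the rescaled acceptance rate `α = lim αN / h`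
    (α : MMC.Vec d → MMC.Vec M → MMC.Vec d → MMC.Vec M → ℝ)
    (hα_cont : Continuous fun q : MMC.Vec d × MMC.Vec M × MMC.Vec d × MMC.Vec M =>
      α q.1 q.2.1 q.2.2.1 q.2.2.2)
    (hα_lim : TendstoLocallyUniformly
      (fun (N : ℕ) (q : MMC.Vec d × MMC.Vec M × MMC.Vec d × MMC.Vec M) =>
        αN N q.1 q.2.1 q.2.2.1 q.2.2.2 / MMC.stepSize c N)
      (fun q => α q.1 q.2.1 q.2.2.1 q.2.2.2) atTop) :
    ∃ f : ℝ → Measure (MMC.Vec d × MMC.Vec M),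
      MMC.IsKineticSolution m τ α ρ f ∧
      (∀ g, MMC.IsKineticSolution m τ α ρ g → ∀ s, 0 < s → g s = f s) ∧
      ∀ φ : (MMC.Vec d × MMC.Vec M) →ᵇ ℝ, ∀ S : ℝ, 0 < S → ∀ ε : ℝ, 0 < ε →
        ∀ᶠ N : ℕ in atTop, ∀ n : ℕ, 1 ≤ n → (n : ℝ) * MMC.stepSize c N ≤ S →
          |(∫ p, φ p ∂(MMC.chainLaw m τ (αN N) ρ n)) -
            ∫ p, φ p ∂(f ((n : ℝ) * MMC.stepSize c N))| < ε := by
  have hτ : MMC.IsFellerDensity τ := ⟨hτ_meas, hτ_nonneg, hτ_one, hτ_cont⟩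
  have hαN : ∀ N, 1 ≤ N → MMC.IsAcceptance (αN N) := fun N hN =>
    ⟨hα_meas N hN, fun x κ y κ' => (hα_mem N hN x κ y κ').1,
      fun x κ y κ' => (hα_mem N hN x κ y κ').2⟩
  have hC : 0 ≤ C := by
    have h1 := hα_order 1 le_rfl 0 0 0 0
    have h2 := (hα_mem 1 le_rfl 0 0 0 0).1
    simp only [MMC.stepSize, Nat.cast_one, Real.one_rpow, mul_one] at h1
    linarith
  -- Any positive `L ≥ C` bounds the rescaled rates; adding one keeps `L` positive when `C = 0`.
  set L : ℝ := C + 1 with hLdef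
  have hL : 0 < L := by linarith
  set h : ℕ → ℝ := MMC.stepSize c with hh
  have hh0 : ∀ N, 0 ≤ h N := MMC.stepSize_nonneg c
  have hhpos : ∀ N, 1 ≤ N → 0 < h N := fun N hN => MMC.stepSize_pos c hN
  have hh1 : Tendsto h atTop (𝓝 0) := MMC.tendsto_stepSize hc1
  set βs : ℕ → MMC.Vec d → MMC.Vec M → MMC.Vec d → MMC.Vec M → ℝ := fun N x κ y κ' =>
    αN N x κ y κ' / h N / L with hβsdef
  have hβs : ∀ N, 1 ≤ N → MMC.IsAcceptance (βs N) := fun N hN =>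
    ⟨((hα_meas N hN).div_const _).div_const _, fun x κ y κ' =>
      div_nonneg (div_nonneg (hα_mem N hN x κ y κ').1 (hh0 N)) hL.le, fun x κ y κ' => by
        rw [show βs N x κ y κ' = αN N x κ y κ' / h N / L from rfl, div_div, div_le_one (mul_pos (hhpos N hN) hL)]
        have := hα_order N hN x κ y κ'
        have := hhpos N hN
        rw [hLdef]
        linarith⟩
  set β : MMC.Vec d → MMC.Vec M → MMC.Vec d → MMC.Vec M → ℝ := fun x κ y κ' =>
    α x κ y κ' / L with hβdef
  have hβl : ∀ q : MMC.Vec d × MMC.Vec M × MMC.Vec d × MMC.Vec M, Tendsto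
      (fun r : ℕ × (MMC.Vec d × MMC.Vec M × MMC.Vec d × MMC.Vec M) =>
        βs r.1 r.2.1 r.2.2.1 r.2.2.2.1 r.2.2.2.2)
      (atTop ×ˢ 𝓝 q) (𝓝 (β q.1 q.2.1 q.2.2.1 q.2.2.2)) := fun q =>
    (MMC.tendsto_prod_of_tendstoLocallyUniformly hα_lim hα_cont q).div_const L
  have hβc : Continuous fun q : MMC.Vec d × MMC.Vec M × MMC.Vec d × MMC.Vec M =>
      β q.1 q.2.1 q.2.2.1 q.2.2.2 := hα_cont.div_const L
  have hβpt : ∀ x κ y κ', Tendsto (fun N => βs N x κ y κ') atTop (𝓝 (β x κ y κ')) :=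
    fun x κ y κ' => (hβl (x, κ, y, κ')).comp
      (tendsto_id.prodMk (tendsto_const_nhds (x := (x, κ, y, κ'))))
  have hβ : MMC.IsAcceptance β :=
    ⟨hβc.measurable, fun x κ y κ' => ge_of_tendsto (hβpt x κ y κ')
        ((eventually_ge_atTop 1).mono fun N hN => (hβs N hN).nonneg _ _ _ _),
      fun x κ y κ' => le_of_tendsto (hβpt x κ y κ')
        ((eventually_ge_atTop 1).mono fun N hN => (hβs N hN).le_one _ _ _ _)⟩
  have hα : ∀ x κ y κ', α x κ y κ' = L * β x κ y κ' := fun x κ y κ' => by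
    rw [hβdef]; field_simp
  have hsol := MMC.isKineticSolution_kineticFlow m ρ hτ hL hβ hα
  refine ⟨MMC.kineticFlow m τ β ρ L, hsol,
    fun g hg s hs => hg.unique m hsol hτ hL hβ hβc hα hs, fun φ S hS ε hε => ?_⟩
  by_contra hcon
  rw [not_eventually] at hcon
  simp only [not_forall, not_lt] at hcon
  set bad : Set ℕ := {N | ∃ n : ℕ, ∃ _ : 1 ≤ n, ∃ _ : (n : ℝ) * h N ≤ S,
    ε ≤ |(∫ p, φ p ∂(MMC.chainLaw m τ (αN N) ρ n)) -
      ∫ p, φ p ∂(MMC.kineticFlow m τ β ρ L ((n : ℝ) * h N))|} with hbad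
  have hex : ∀ N, ∃ n : ℕ, N ∈ bad → 1 ≤ n ∧ (n : ℝ) * h N ≤ S ∧
      ε ≤ |(∫ p, φ p ∂(MMC.chainLaw m τ (αN N) ρ n)) -
        ∫ p, φ p ∂(MMC.kineticFlow m τ β ρ L ((n : ℝ) * h N))| := by
    intro N
    by_cases hN : N ∈ bad
    · obtain ⟨n, h1, h2, h3⟩ := hN
      exact ⟨n, fun _ => ⟨h1, h2, h3⟩⟩
    · exact ⟨0, fun h => absurd h hN⟩
  choose n hn using hex
  have hne : (atTop ⊓ 𝓟 bad).NeBot := frequently_mem_iff_neBot.1 hcon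
  have hmem : ∀ᶠ N in atTop ⊓ 𝓟 bad, N ∈ bad := mem_inf_of_right (mem_principal_self bad)
  obtain ⟨t, -, ht⟩ := (isCompact_Icc (a := (0 : ℝ)) (b := S)).exists_clusterPt
    (f := map (fun N => (n N : ℝ) * h N) (atTop ⊓ 𝓟 bad))
    (le_principal_iff.2 (hmem.mono fun N hN =>
      ⟨mul_nonneg (Nat.cast_nonneg _) (hh0 N), (hn N hN).2.1⟩))
  -- This filter lives on the failing indices and makes `n h` converge to the cluster point `t`; it
  -- plays the part of a convergent subsequence.
  set l : Filter ℕ := comap (fun N => (n N : ℝ) * h N) (𝓝 t) ⊓ (atTop ⊓ 𝓟 bad) with hldef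
  have hlne : l.NeBot := by
    have ht' : (𝓝 t ⊓ map (fun N => (n N : ℝ) * h N) (atTop ⊓ 𝓟 bad)).NeBot := ht
    rw [← Filter.push_pull', map_neBot_iff] at ht'
    exact ht'
  have hlt : Tendsto (fun N => (n N : ℝ) * h N) l (𝓝 t) := tendsto_comap.mono_left inf_le_left
  have hl : l ≤ atTop := inf_le_right.trans inf_le_left
  have hlbad : ∀ᶠ N in l, N ∈ bad := (inf_le_right : l ≤ _) hmem
  have hγl : Tendsto (fun N => L * h N) l (𝓝 0) := by
    simpa using (hh1.mono_left hl).const_mul L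
  -- The state of index `n` is reached after `n - 1` steps; the missing step costs `L h → 0`.
  have hk : Tendsto (fun N => ((n N - 1 : ℕ) : ℝ) * (L * h N)) l (𝓝 (L * t)) := by
    have h1 : Tendsto (fun N => L * ((n N : ℝ) * h N) - L * h N) l (𝓝 (L * t)) := by
      simpa using (hlt.const_mul L).sub hγl
    refine h1.congr' ?_
    filter_upwards [hlbad] with N hN
    rw [Nat.cast_sub (hn N hN).1]
    push_cast
    ring
  have hchain := MMC.tendsto_integral_chainLaw m ρ hτ hβ hβs hβl hαN (γ := fun N => L * h N)
    (fun N => mul_nonneg hL.le (hh0 N)) (fun N hN x κ y κ' => by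
      have := (hhpos N hN).ne'
      simp only [hβsdef]
      field_simp) hl hγl hk φ
  have hφB : ∀ p, |φ p| ≤ ‖φ‖ := φ.norm_coe_le_norm
  have hflow : Tendsto (fun N => ∫ p, φ p ∂(MMC.kineticFlow m τ β ρ L ((n N : ℝ) * h N))) l
      (𝓝 (∑' j, Real.exp (-(L * t)) * ((L * t) ^ j * ∫ p, φ p ∂(MMC.jumpPart m τ β ρ j)))) := by
    have hd := MMC.hasDerivAt_tsum_pow_mul
      (fun j => MMC.abs_integral_jumpPart_le m ρ hτ hβ j hφB) (L * t)
    have h1 : Tendsto (fun N => L * ((n N : ℝ) * h N)) l (𝓝 (L * t)) := hlt.const_mul L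
    have h2 := ((Real.continuous_exp.tendsto _).comp h1.neg).mul (hd.continuousAt.tendsto.comp h1)
    rw [tsum_mul_left]
    refine h2.congr fun N => ?_
    rw [MMC.integral_kineticFlow m ρ hτ hβ hL.le (mul_nonneg (Nat.cast_nonneg _) (hh0 N))
      φ.continuous.measurable hφB]
    rfl
  have hdiff := (hchain.sub hflow).abs
  rw [sub_self, abs_zero] at hdiff
  obtain ⟨N, hN1, hN2⟩ := (hlbad.and (hdiff.eventually (gt_mem_nhds hε))).exists
  obtain ⟨h1, -, h3⟩ := hn N hN1
  rw [Nat.sub_add_cancel h1] at hN2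
  exact absurd hN2 (not_lt.2 h3)
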